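/- **Setting.** *Atoms* are a relational structure $\mathbb{A}=(U,R_1,\dots,R_\ell)$ with a countably infinite universe $U$ and finitely many relations, one of which is equality on $U$. A *data word* over a finite alphabet $\Sigma$ and $\mathbb{A}$ is a word $(\sigma_1,\alpha_1)\cdots(\sigma_n,\alpha_n)\in(\Sigma\times U)^*$. **Register automata.** A *nondeterministic register automaton with guessing* over $\Sigma$ and $\mathbb{A}$ (an element of $\mathrm{NRA}^{g}[\Sigma,\mathbb{A}]$) consists of a finite set $Q$ of states, sets $Q_{\mathrm{ini}},Q_{\mathrm{fin}}\subseteq Q$ of initial and accepting states, a finite set $\mathcal R$ of registers, and a finite set $\delta$ of rules $(p,\sigma,\Phi,q)$ with $p,q\in Q$, $\sigma\in\Sigma$, where $\Phi$ is a quantifier-free formula over the relation symbols of $\mathbb{A}$ and an additional unary symbol $\mathrm{nil}$, whose variables stand for the current data value and for the content of each register before and after the transition. Registers hold values in $U\cup\{\underline{\mathrm{nil}}\}$, where $\underline{\mathrm{nil}}\notin U$; the symbol $\mathrm{nil}$ is interpreted as $\{\underline{\mathrm{nil}}\}$, and the relations $R_i$ hold only for tuples of elements of $U$. An accepting run over $(\sigma_1,\alpha_1)\cdots(\sigma_n,\alpha_n)$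 is a sequence $(q_0,\mu_0),\dots,(q_n,\mu_n)$ of states and register valuations $\mu_m\colon\mathcal R\to U\cup\{\underline{\mathrm{nil}}\}$ such that $q_0\in Q_{\mathrm{ini}}$, all registers are $\underline{\mathrm{nil}}$ in $\mu_0$, $q_n\in Q_{\mathrm{fin}}$, and for every $m\in\{1,\dots,n\}$ there is a rule $(q_{m-1},\sigma_m,\Phi,q_m)\in\delta$ whose $\Phi$ holds for $\mu_{m-1},\alpha_m,\mu_m$. The language $\mathcal L(\mathcal A)$ is the set of data words that have an accepting run. In a run, step $a\ge 1$ *guesses* $\xi\in U$ if $\xi\in\mu_a(\mathcal R)$, $\xi\notin\mu_{a-1}(\mathcal R)$ and $\xi\neq\alpha_a$. The live interval of this guess is the longest $\{a,\dots,b\}\subseteq\{1,\dots,n\}$ with $\xi\in\mu_m(\mathcal R)$ for all $a\le m\le b$. The guess is *strong* if $\alpha_m\ne\xi$ for all $m\in\{a,\dots,b\}$. An automaton is *weakly guessing* if no accepting run of it contains a strong guess. The atoms $\mathbb{A}$ *have elimination of strong guessing* if, for every finite alphabet $\Sigma$, every $\mathcal A\in\mathrm{NRA}^{g}[\Sigma,\mathbb{A}]$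 has the same language as some weakly guessing $\mathcal B\in\mathrm{NRA}^{g}[\Sigma,\mathbb{A}]$. **Scoped MSO.** Formulas are generated by $$\varphi,\psi ::= \exists x\,\varphi\mid\exists X\,\varphi\mid \mathsf S_X\varphi\mid\varphi\land\psi\mid\varphi\lor\psi\mid\neg\varphi\mid x<y\mid X(x)\mid a(x)\mid R_i(x_1,\dots,x_r),$$ with first-order variables $x,y,\dots$, second-order variables $X,Y,\dots$, letters $a\in\Sigma$ and $r$ the arity of $R_i$; the operator $\mathsf S_X$ does not bind $X$. A first-order variable is *nested* if its binding quantifier occurs within the scope of a negation. A formula is *well-formed* if each of its subformulas $R_i(x_1,\dots,x_r)$ contains at most one nested variable (possibly repeated). $\mathrm{MSO}_{\mathrm S}[\Sigma,\mathbb{A}]$ is the set of well-formed formulas. Formulas are interpreted in a data word of length $n$, under a valuation $\nu$ of the free variables by positions and sets of positions in $\{1,\dots,n\}$, and in a scope, i.e. a range of positions $I=\{a,\dots,b\}$ (empty if $b=a-1$). Atomic formulas do not depend on $I$: $a(x)$ says that the letter at $\nu(x)$ is $a$, and $R_i(x_1,\dots,x_r)$ says that the data values at $\nu(x_1),\dots,\nu(x_r)$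 are related by $R_i$. The formulas $\exists x\,\varphi$ and $\exists X\,\varphi$ quantify over positions in $I$ and over subsets of $I$. The formula $\mathsf S_X\varphi$ holds in the scope $I$ if $\varphi$ holds, under the same valuation, in every scope $\{a',\dots,b'\}$ such that $a'$ and $b'+1$ are consecutive elements of the set $(\nu(X)\cap I)\cup\{a,b+1\}$. The language $\mathcal L(\varphi)$ of a sentence $\varphi$ is the set of data words in which $\varphi$ holds when the scope consists of all positions. **Theorem.** If the atoms $\mathbb{A}$ have elimination of strong guessing, then for every finite alphabet $\Sigma$ $$\{\mathcal L(\mathcal A) : \mathcal A\in\mathrm{NRA}^{g}[\Sigma,\mathbb{A}]\}=\{\mathcal L(\varphi) : \varphi\text{ a sentence of }\mathrm{MSO}_{\mathrm S}[\Sigma,\mathbb{A}]\}.$$ -/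

import Mathlib

universe u v

namespace ScopedMSO

/-- Atoms `𝔸 = (U, R₁, …, R_ℓ)`: finitely many relations on the universe `U`, one of which is the
equality of elements of `U`. (That `U` is countably infinite is stated where atoms are used.) -/
structure Atoms (U : Type u) where
  /-- the number of relation symbols -/
  numRel : ℕ
  /-- the arity of each relation symbol -/
  arity : Fin numRel → ℕ
  /-- the interpretation of each relation symbol -/
  rel : (i : Fin numRel) → (Fin (arity i) → U) → Prop
  /-- one of the relations is equality -/
  exists_eq : ∃ (i : Fin numRel) (h : arity i = 2),
    ∀ a b : U, rel i (fun j => ![a, b] (Fin.cast h j)) ↔ a = b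

variable {U : Type u}

/-! ### Register automata with guessing -/

/-- Quantifier-free formulas with variables in `V` over the atoms `𝔸` extended by a fresh element
`nil` and by a unary symbol for it. -/
inductive QFFormula (𝔸 : Atoms U) (V : Type) : Type
  | top : QFFormula 𝔸 V
  | neg : QFFormula 𝔸 V → QFFormula 𝔸 V
  | and : QFFormula 𝔸 V → QFFormula 𝔸 V → QFFormula 𝔸 V
  | rel : (i : Fin 𝔸.numRel) → (Fin (𝔸.arity i) → V) → QFFormula 𝔸 V
  | isNil : V → QFFormula 𝔸 V

/-- Truth of a quantifier-free formula under a valuation in `𝔸 ∪ {nil}`, modelled as `Option U` with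
`none` for `nil`. The relations of `𝔸` are unchanged: they hold for tuples of elements of `U` only. -/
def QFFormula.Holds {𝔸 : Atoms U} {V : Type} (ν : V → Option U) : QFFormula 𝔸 V → Prop
  | .top => True
  | .neg φ => ¬ φ.Holds ν
  | .and φ ψ => φ.Holds ν ∧ ψ.Holds ν
  | .rel i x => ∃ a : Fin (𝔸.arity i) → U, (∀ j, ν (x j) = some (a j)) ∧ 𝔸.rel i a
  | .isNil x => ν x = none

/-- The variables of register constraints: the current data value, and every register before and
after the transition. -/
inductive ConstrVar (R : Type) : Type
  | input : ConstrVar R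
  | pre : R → ConstrVar R
  | post : R → ConstrVar R

/-- The valuation of constraint variables induced by the register valuation `μ` before, the data
value `α` that is read, and the register valuation `μ'` after the transition. -/
def constrVal {R : Type} (μ : R → Option U) (α : U) (μ' : R → Option U) :
    ConstrVar R → Option U
  | .input => some α
  | .pre r => μ r
  | .post r => μ' r

/-- Nondeterministic register automata with guessing over the alphabet `σ` and the atoms `𝔸`. -/
structure NRA (σ : Type v) (𝔸 : Atoms U) where
  /-- states -/
  Q : Type
  finite_Q : Finite Q
  /-- registers -/
  R : Type
  finite_R : Finite R
  /-- initial states -/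
  initial : Set Q
  /-- accepting states -/
  accepting : Set Q
  /-- transition rules -/
  rules : Set (Q × σ × QFFormula 𝔸 (ConstrVar R) × Q)
  finite_rules : rules.Finite

namespace NRA

variable {σ : Type v} {𝔸 : Atoms U}

/-- Configurations: a state and a register valuation in `𝔸 ∪ {nil}`. -/
abbrev Conf (A : NRA σ 𝔸) : Type u := A.Q × (A.R → Option U)

/-- The transition relation on configurations. -/
def Step (A : NRA σ 𝔸) (c : A.Conf) (s : σ × U) (c' : A.Conf) : Prop :=
  ∃ Φ : QFFormula 𝔸 (ConstrVar A.R),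
    (c.1, s.1, Φ, c'.1) ∈ A.rules ∧ Φ.Holds (constrVal c.2 s.2 c'.2)

/-- `c` is an accepting run over the data word `w` of length `n`. Its transition number `i` (counted
from `0`) leads from `c i.castSucc` to `c i.succ` and reads `w i`. -/
structure IsAcceptingRun (A : NRA σ 𝔸) {n : ℕ} (w : Fin n → σ × U) (c : Fin (n + 1) → A.Conf) :
    Prop where
  initial_state : (c 0).1 ∈ A.initial
  initial_nil : ∀ r, (c 0).2 r = none
  step : ∀ i : Fin n, A.Step (c i.castSucc) (w i) (c i.succ)
  accepting_state : (c (Fin.last n)).1 ∈ A.accepting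

/-- The language of data words that label accepting runs. -/
def language (A : NRA σ 𝔸) : Language (σ × U) :=
  {w | ∃ c : Fin (w.length + 1) → A.Conf, A.IsAcceptingRun w.get c}

/-- Some register holds the data value `ξ` after transition number `i`. -/
def Stores (A : NRA σ 𝔸) {n : ℕ} (c : Fin (n + 1) → A.Conf) (i : Fin n) (ξ : U) : Prop :=
  ∃ r, (c i.succ).2 r = some ξ

/-- Transition number `i` guesses the data value `ξ`: some register holds `ξ` after the transition,
while no register holds it before, and `ξ` is not the data value being read. -/
def Guesses (A : NRA σ 𝔸) {n : ℕ} (w : Fin n → σ × U) (c : Fin (n + 1) → A.Conf) (i : Fin n)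
    (ξ : U) : Prop :=
  A.Stores c i ξ ∧ (∀ r, (c i.castSucc).2 r ≠ some ξ) ∧ (w i).2 ≠ ξ

/-- The live interval of `ξ` that starts after transition number `i` ends with the valuation after
transition number `j`: some register holds `ξ` after each of the transitions `i, …, j`, and no
register holds it after transition `j + 1`, or the run is over. -/
def LiveInterval (A : NRA σ 𝔸) {n : ℕ} (c : Fin (n + 1) → A.Conf) (i j : Fin n) (ξ : U) : Prop :=
  i ≤ j ∧ (∀ m, i ≤ m → m ≤ j → A.Stores c m ξ) ∧
    ∀ m : Fin n, (m : ℕ) = j + 1 → ¬ A.Stores c m ξ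

/-- Transition number `i` guesses `ξ` strongly: `ξ` is not read during its live interval. -/
def GuessesStrongly (A : NRA σ 𝔸) {n : ℕ} (w : Fin n → σ × U) (c : Fin (n + 1) → A.Conf)
    (i : Fin n) (ξ : U) : Prop :=
  A.Guesses w c i ξ ∧
    ∃ j, A.LiveInterval c i j ξ ∧ ∀ m, i ≤ m → m ≤ j → (w m).2 ≠ ξ

/-- An automaton is weakly guessing if no accepting run contains a strong guess. -/
def WeaklyGuessing (A : NRA σ 𝔸) : Prop :=
  ∀ (n : ℕ) (w : Fin n → σ × U) (c : Fin (n + 1) → A.Conf), A.IsAcceptingRun w c →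
    ∀ i ξ, ¬ A.GuessesStrongly w c i ξ

end NRA

/-- The atoms have elimination of strong guessing: over every finite alphabet, every automaton has
an equivalent weakly guessing one. -/
def Atoms.EliminatesStrongGuessing (𝔸 : Atoms U) : Prop :=
  ∀ (σ : Type v) [Finite σ] (A : NRA σ 𝔸), ∃ B : NRA σ 𝔸, B.WeaklyGuessing ∧ B.language = A.language

/-! ### Scoped MSO -/

/-- Formulas of Scoped MSO (before the well-formedness condition) whose free first-order and
second-order variables are indexed by `Fin k` and `Fin l`. A quantifier binds the variable with
index `0` and shifts the other indices by one. `seg X φ` is the scope modality. -/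
inductive Formula (σ : Type v) (𝔸 : Atoms U) : ℕ → ℕ → Type v
  | ex {k l : ℕ} : Formula σ 𝔸 (k + 1) l → Formula σ 𝔸 k l
  | exSet {k l : ℕ} : Formula σ 𝔸 k (l + 1) → Formula σ 𝔸 k l
  | seg {k l : ℕ} : Fin l → Formula σ 𝔸 k l → Formula σ 𝔸 k l
  | and {k l : ℕ} : Formula σ 𝔸 k l → Formula σ 𝔸 k l → Formula σ 𝔸 k l
  | or {k l : ℕ} : Formula σ 𝔸 k l → Formula σ 𝔸 k l → Formula σ 𝔸 k l
  | neg {k l : ℕ} : Formula σ 𝔸 k l → Formula σ 𝔸 k l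
  | lt {k l : ℕ} : Fin k → Fin k → Formula σ 𝔸 k l
  | mem {k l : ℕ} : Fin l → Fin k → Formula σ 𝔸 k l
  | letter {k l : ℕ} : σ → Fin k → Formula σ 𝔸 k l
  | rel {k l : ℕ} : (i : Fin 𝔸.numRel) → (Fin (𝔸.arity i) → Fin k) → Formula σ 𝔸 k l

/-- A scope: the pair `(a, e)` stands for the range of positions `a, a + 1, …, e - 1`, so `e` is one
more than the last position. Positions are counted from `0`. -/
abbrev Scope := ℕ × ℕ

/-- `X ∩ I` together with the start of `I` and the successor of its end. -/
def splitPoints (I : Scope) (X : Set ℕ) : Set ℕ :=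
  (X ∩ Set.Ico I.1 I.2) ∪ {I.1, I.2}

/-- The subscopes obtained by cutting `I` at every position in `X`: those given by two consecutive
elements of `splitPoints I X`. -/
def subs (I : Scope) (X : Set ℕ) : Set Scope :=
  {J | J.1 ∈ splitPoints I X ∧ J.2 ∈ splitPoints I X ∧ J.1 < J.2 ∧
    ∀ c ∈ splitPoints I X, ¬ (J.1 < c ∧ c < J.2)}

namespace Formula

variable {σ : Type v} {𝔸 : Atoms U}

/-- The well-formedness condition for a subformula. `underNeg` says whether the subformula occurs
within the scope of a negation, and `nested` which of the variables in its context are nested, i.e.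
have their binding quantifier within the scope of a negation. Every data atomic formula may contain
at most one nested variable (which may be repeated). -/
def WF : {k l : ℕ} → Formula σ 𝔸 k l → (underNeg : Prop) → (nested : Fin k → Prop) → Prop
  | _, _, .ex φ, b, nested => φ.WF b (Fin.cons b nested)
  | _, _, .exSet φ, b, nested => φ.WF b nested
  | _, _, .seg _ φ, b, nested => φ.WF b nested
  | _, _, .and φ ψ, b, nested => φ.WF b nested ∧ ψ.WF b nested
  | _, _, .or φ ψ, b, nested => φ.WF b nested ∧ ψ.WF b nested
  | _, _, .neg φ, _, nested => φ.WF True nested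
  | _, _, .lt _ _, _, _ => True
  | _, _, .mem _ _, _, _ => True
  | _, _, .letter _ _, _, _ => True
  | _, _, .rel _ x, _, nested => ∀ i j, nested (x i) → nested (x j) → x i = x j

/-- The well-formed sentences, i.e. the sentences of Scoped MSO. -/
def WellFormed (φ : Formula σ 𝔸 0 0) : Prop := φ.WF False Fin.elim0

/-- Satisfaction in the structure of the data word `w` of length `n`, under the valuations `ν` and
`V` of the free first-order and second-order variables, in the scope `I`. -/
def Sat {n : ℕ} (w : Fin n → σ × U) :
    {k l : ℕ} → Formula σ 𝔸 k l → (Fin k → Fin n) → (Fin l → Set (Fin n)) → Scope → Prop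
  | _, _, .ex φ, ν, V, I => ∃ p : Fin n, (p : ℕ) ∈ Set.Ico I.1 I.2 ∧ φ.Sat w (Fin.cons p ν) V I
  | _, _, .exSet φ, ν, V, I =>
      ∃ P : Set (Fin n), (∀ p ∈ P, (p : ℕ) ∈ Set.Ico I.1 I.2) ∧ φ.Sat w ν (Fin.cons P V) I
  | _, _, .seg X φ, ν, V, I => ∀ J ∈ subs I (Fin.val '' V X), φ.Sat w ν V J
  | _, _, .and φ ψ, ν, V, I => φ.Sat w ν V I ∧ ψ.Sat w ν V I
  | _, _, .or φ ψ, ν, V, I => φ.Sat w ν V I ∨ ψ.Sat w ν V I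
  | _, _, .neg φ, ν, V, I => ¬ φ.Sat w ν V I
  | _, _, .lt x y, ν, _, _ => ν x < ν y
  | _, _, .mem X x, ν, V, _ => ν x ∈ V X
  | _, _, .letter a x, ν, _, _ => (w (ν x)).1 = a
  | _, _, .rel i x, ν, _, _ => 𝔸.rel i (fun j => (w (ν (x j))).2)

/-- The language of a sentence: the data words in which it holds, the scope being all positions. -/
def language (φ : Formula σ 𝔸 0 0) : Language (σ × U) :=
  {w | φ.Sat w.get Fin.elim0 Fin.elim0 (0, w.length)}

end Formula

end ScopedMSO

namespace ScopedMSO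

variable {U : Type u} {σ : Type v} {𝔸 : Atoms U}

/-! ### Scopes -/

/-! From formulas to automata. Nonempty segments are recognised by tiling automata, which label
positions with states and register contents. These are closed under conjunction, disjunction, both
existential quantifiers and `S_X` (the run restarts at every cut), whereas complementation is
available only in the absence of data (`Rec.compl`). Well-formedness rescues negation. Variables
quantified outside all negations have their data values kept as parameters in registers, and below
the outermost negation a data atom mentions at most one further variable, so its truth is determined
by the parameters and the data value at one position. Once every letter is annotated with these
finitely many truth values, the subformula speaks about a word without data, and the subset
construction applies. Elimination of strong guessing plays no role in this direction.

From automata to formulas. The automaton may be taken weakly guessing, so every stored value is read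
while it is stored, at a position that serves as its witness. The sentence guesses the transitions
by sets and must evaluate their constraints on data at witnesses. It does so inside nested scopes
`S_X ∃ x …`: every level contributes one unnested variable, which stands for one witness per scope,
and the transition itself is the only nested variable in any data atom.

At most twice as many witnesses as registers are in use at a transition. A greedy covering argument
(`TokenFamily.exists_blocks`, `TokenFamily.exists_levels`) sorts the witnesses into boundedly many
levels and divides the word into blocks, for each level `i`, such that a witness of level at most
`i` is at most one block away from its uses, and each block uses at most one witness of level `i`.
If level `i` is cut at every third block, the transitions in the middle block of each triple find
their witnesses in their own scope. Three shifts of the cuts cover all transitions, which is why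
there is one conjunct for every vector of phases. All scopes and conjuncts must agree on what a
register contains: a pointer names the nearest marked position of a level on a given side, and this
does not depend on the scope (`Near.eq`). -/

theorem mem_subs_iff {I J : Scope} (hI : I.1 ≤ I.2) {X : Set ℕ} :
    J ∈ subs I X ↔ I.1 ≤ J.1 ∧ J.1 < J.2 ∧ J.2 ≤ I.2 ∧ (J.1 = I.1 ∨ J.1 ∈ X) ∧
      (J.2 = I.2 ∨ J.2 ∈ X) ∧ ∀ c, J.1 < c → c < J.2 → c ∉ X := by
  simp only [subs, splitPoints, Set.mem_ofPred_eq, Set.mem_union, Set.mem_inter_iff, Set.mem_Ico,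
    Set.mem_insert_iff, Set.mem_singleton_iff]
  constructor
  · rintro ⟨h1, h2, h3, h4⟩
    have h5 := h4 I.1
    have h6 := h4 I.2
    refine ⟨by omega, h3, by omega, ?_, ?_, fun c hc hc' hX => ?_⟩
    · rcases h1 with h | h | h
      · exact .inr h.1
      · exact .inl h
      · omega
    · rcases h2 with h | h | h
      · exact .inr h.1
      · omega
      · exact .inl h
    · exact h4 c (.inl ⟨hX, by omega, by omega⟩) ⟨hc, hc'⟩
  · rintro ⟨h1, h2, h3, h4, h5, h6⟩
    refine ⟨?_, ?_, h2, ?_⟩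
    · rcases h4 with h | h
      · exact .inr (.inl h)
      · exact .inl ⟨h, h1, by omega⟩
    · by_cases h : J.2 = I.2
      · exact .inr (.inr h)
      · rcases h5 with h' | h'
        · exact absurd h' h
        · exact .inl ⟨h', by omega, by omega⟩
    · rintro c (hc | hc | hc) ⟨hc1, hc2⟩
      · exact h6 c hc1 hc2 hc.1
      · omega
      · omega

theorem exists_mem_subs {I : Scope} (X : Set ℕ) {m : ℕ} (h1 : I.1 ≤ m) (h2 : m < I.2) :
    ∃ J ∈ subs I X, J.1 ≤ m ∧ m < J.2 := by
  classical
  have hs : ∃ s, I.1 ≤ s ∧ s ≤ m ∧ (s = I.1 ∨ s ∈ X) ∧ ∀ c, s < c → c ≤ m → c ∉ X := by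
    induction m, h1 using Nat.le_induction with
    | base => exact ⟨I.1, le_rfl, le_rfl, .inl rfl, fun c _ _ => by omega⟩
    | succ m hm ih =>
      by_cases hX : m + 1 ∈ X
      · exact ⟨m + 1, by omega, le_rfl, .inr hX, fun c _ _ => by omega⟩
      · obtain ⟨s, h3, h4, h5, h6⟩ := ih (by omega)
        refine ⟨s, h3, by omega, h5, fun c hc hc' => ?_⟩
        by_cases hcm : c = m + 1
        · exact hcm ▸ hX
        · exact h6 c hc (by omega)
  have he : ∃ t, m < t ∧ (t = I.2 ∨ t ∈ X) := ⟨I.2, h2, .inl rfl⟩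
  obtain ⟨s, h3, h4, h5, h6⟩ := hs
  have h7 := Nat.find_spec he
  have h8 : Nat.find he ≤ I.2 := Nat.find_min' he ⟨h2, .inl rfl⟩
  refine ⟨(s, Nat.find he), (mem_subs_iff (by omega)).2
    ⟨h3, by dsimp; omega, h8, h5, h7.2, fun c hc hc' hX => ?_⟩, h4, h7.1⟩
  by_cases hcm : c ≤ m
  · exact h6 c hc hcm hX
  · exact Nat.find_min he hc' ⟨by omega, .inr hX⟩

/-! ### Satisfaction with natural numbers as positions -/

namespace Formula

/-- Satisfaction in an infinite data word, where all quantifiers are bounded by the scope. -/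
def NSat (w : ℕ → σ × U) :
    {k l : ℕ} → Formula σ 𝔸 k l → (Fin k → ℕ) → (Fin l → Set ℕ) → Scope → Prop
  | _, _, .ex φ, ν, V, I => ∃ p ∈ Set.Ico I.1 I.2, φ.NSat w (Fin.cons p ν) V I
  | _, _, .exSet φ, ν, V, I => ∃ P ⊆ Set.Ico I.1 I.2, φ.NSat w ν (Fin.cons P V) I
  | _, _, .seg X φ, ν, V, I => ∀ J ∈ subs I (V X), φ.NSat w ν V J
  | _, _, .and φ ψ, ν, V, I => φ.NSat w ν V I ∧ ψ.NSat w ν V I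
  | _, _, .or φ ψ, ν, V, I => φ.NSat w ν V I ∨ ψ.NSat w ν V I
  | _, _, .neg φ, ν, V, I => ¬ φ.NSat w ν V I
  | _, _, .lt x y, ν, _, _ => ν x < ν y
  | _, _, .mem X x, ν, V, _ => ν x ∈ V X
  | _, _, .letter a x, ν, _, _ => (w (ν x)).1 = a
  | _, _, .rel i x, ν, _, _ => 𝔸.rel i (fun j => (w (ν (x j))).2)

/-- Quantifiers are bounded by the scope and subscopes stay inside it, so what lies beyond the word
is never seen. Runs can then be handled as functions on `ℕ`. -/
theorem sat_iff_nsat {n : ℕ} (w : Fin n → σ × U) (w' : ℕ → σ × U) (hw : ∀ i : Fin n, w' i = w i)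
    {k l : ℕ} (φ : Formula σ 𝔸 k l) (ν : Fin k → Fin n) (V : Fin l → Set (Fin n)) (I : Scope)
    (hI : I.1 ≤ I.2) (hn : I.2 ≤ n) :
    φ.Sat w ν V I ↔ φ.NSat w' (fun x => (ν x : ℕ)) (fun X => Fin.val '' V X) I := by
  induction φ generalizing I with
  | ex φ ih =>
    simp only [Sat, NSat]
    have key (p : Fin n) : (fun x => ((Fin.cons p ν : Fin _ → Fin n) x : ℕ)) =
        Fin.cons (p : ℕ) (fun x => (ν x : ℕ)) := by
      funext x; refine Fin.cases ?_ (fun x => ?_) x <;> simp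
    constructor
    · rintro ⟨p, hp, h⟩
      exact ⟨p, hp, by rw [← key]; exact (ih _ _ _ hI hn).1 h⟩
    · rintro ⟨p, hp, h⟩
      refine ⟨⟨p, lt_of_lt_of_le hp.2 hn⟩, hp, (ih _ _ _ hI hn).2 ?_⟩
      rw [key]; exact h
  | exSet φ ih =>
    simp only [Sat, NSat]
    have key (P : Set (Fin n)) : (fun X => Fin.val '' (Fin.cons P V : Fin _ → Set (Fin n)) X) =
        Fin.cons (Fin.val '' P) (fun x => Fin.val '' V x) := by
      funext x; refine Fin.cases ?_ (fun x => ?_) x <;> simp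
    constructor
    · rintro ⟨P, hP, h⟩
      exact ⟨Fin.val '' P, by rintro _ ⟨p, hp, rfl⟩; exact hP p hp,
        by rw [← key]; exact (ih _ _ _ hI hn).1 h⟩
    · rintro ⟨P, hP, h⟩
      refine ⟨{p | (p : ℕ) ∈ P}, fun p hp => hP hp, (ih _ _ _ hI hn).2 ?_⟩
      rw [key]
      convert h
      ext p
      simp only [Set.mem_image, Set.mem_ofPred_eq]
      exact ⟨by rintro ⟨q, hq, rfl⟩; exact hq,
        fun hp => ⟨⟨p, lt_of_lt_of_le (hP hp).2 hn⟩, hp, rfl⟩⟩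
  | seg X φ ih =>
    simp only [Sat, NSat]
    refine forall₂_congr fun J hJ => ih _ _ _ ?_ ?_
    · exact ((mem_subs_iff hI).1 hJ).2.1.le
    · exact ((mem_subs_iff hI).1 hJ).2.2.1.trans hn
  | and φ ψ ih1 ih2 => simp only [Sat, NSat, ih1 _ _ _ hI hn, ih2 _ _ _ hI hn]
  | or φ ψ ih1 ih2 => simp only [Sat, NSat, ih1 _ _ _ hI hn, ih2 _ _ _ hI hn]
  | neg φ ih => simp only [Sat, NSat, ih _ _ _ hI hn]
  | lt x y => simp [Sat, NSat]
  | mem X x => simp [Sat, NSat, Fin.val_inj]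
  | letter a x => simp [Sat, NSat, hw]
  | rel i x => simp [Sat, NSat, hw]

end Formula

/-- A list as an infinite word, continued by a constant. -/
def extendWord {A : Type*} (w : List A) (h : 0 < w.length) (m : ℕ) : A :=
  if hm : m < w.length then w.get ⟨m, hm⟩ else w.get ⟨0, h⟩

@[simp] theorem extendWord_fin {A : Type*} (w : List A) (h : 0 < w.length) (i : Fin w.length) :
    extendWord w h i = w.get i := by simp [extendWord]

namespace Formula

/-- The empty word has no letter to continue it with. It is excluded here and treated separately in
both directions of the theorem. -/
theorem mem_language_iff (φ : Formula σ 𝔸 0 0) (w : List (σ × U)) (h : 0 < w.length) :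
    w ∈ φ.language ↔ φ.NSat (extendWord w h) Fin.elim0 Fin.elim0 (0, w.length) := by
  change φ.Sat w.get Fin.elim0 Fin.elim0 (0, w.length) ↔ _
  rw [sat_iff_nsat w.get (extendWord w h) (extendWord_fin w h) φ _ _ _ (Nat.zero_le _) le_rfl]
  have h1 : (fun x => ((Fin.elim0 x : Fin w.length) : ℕ)) = (Fin.elim0 : Fin 0 → ℕ) :=
    Subsingleton.elim _ _
  have h2 : (fun X => Fin.val '' (Fin.elim0 X : Set (Fin w.length))) =
      (Fin.elim0 : Fin 0 → Set ℕ) := Subsingleton.elim _ _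
  rw [h1, h2]

end Formula

/-! ### Quantifier-free definable predicates -/

namespace QFFormula

/-- Renaming of variables. -/
def map {V W : Type} (f : V → W) : QFFormula 𝔸 V → QFFormula 𝔸 W
  | .top => .top
  | .neg φ => .neg (φ.map f)
  | .and φ ψ => .and (φ.map f) (ψ.map f)
  | .rel i x => .rel i (f ∘ x)
  | .isNil x => .isNil (f x)

theorem holds_map {V W : Type} (f : V → W) (φ : QFFormula 𝔸 V) (ν : W → Option U) :
    (φ.map f).Holds ν ↔ φ.Holds (ν ∘ f) := by
  induction φ with
  | top => simp [map, Holds]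
  | neg φ ih => simp [map, Holds, ih]
  | and φ ψ ih1 ih2 => simp [map, Holds, ih1, ih2]
  | rel i x => simp [map, Holds]
  | isNil x => simp [map, Holds]

/-- The formula stating the equality of two elements of the universe. -/
noncomputable def eq (𝔸 : Atoms U) {V : Type} (x y : V) : QFFormula 𝔸 V :=
  .rel 𝔸.exists_eq.choose (fun j => ![x, y] (Fin.cast 𝔸.exists_eq.choose_spec.choose j))

theorem holds_eq {V : Type} (x y : V) (ν : V → Option U) :
    (eq 𝔸 x y).Holds ν ↔ ∃ a, ν x = some a ∧ ν y = some a := by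
  have hi := 𝔸.exists_eq.choose_spec.choose
  have hs := 𝔸.exists_eq.choose_spec.choose_spec
  unfold eq Holds
  constructor
  · rintro ⟨a, ha, h⟩
    have h0 := ha (Fin.cast hi.symm 0)
    have h1 := ha (Fin.cast hi.symm 1)
    simp only [Fin.cast_cast, Fin.cast_eq_self, Matrix.cons_val_zero, Matrix.cons_val_one] at h0 h1
    have : a = fun j => ![a (Fin.cast hi.symm 0), a (Fin.cast hi.symm 1)] (Fin.cast hi j) := by
      funext j
      obtain ⟨j, rfl⟩ : ∃ j', j = Fin.cast hi.symm j' := ⟨Fin.cast hi j, by simp⟩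
      fin_cases j <;> simp
    rw [this] at h
    exact ⟨_, h0, by rw [h1, (hs _ _).1 h]⟩
  · rintro ⟨a, hx, hy⟩
    have h : ∀ j : Fin 2, ν (![x, y] j) = some (![a, a] j) := by
      intro j
      fin_cases j <;> simp [hx, hy]
    exact ⟨fun j => ![a, a] (Fin.cast hi j), fun j => h _, (hs a a).2 rfl⟩

theorem exists_forall {V : Type} {ι : Type*} [Finite ι] (φ : ι → QFFormula 𝔸 V) :
    ∃ ψ : QFFormula 𝔸 V, ∀ ν, ψ.Holds ν ↔ ∀ i, (φ i).Holds ν := by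
  obtain ⟨l, hl⟩ := Finite.exists_univ_list ι
  suffices h : ∀ l : List ι, ∃ ψ : QFFormula 𝔸 V, ∀ ν, ψ.Holds ν ↔ ∀ i ∈ l, (φ i).Holds ν by
    obtain ⟨ψ, hψ⟩ := h l
    exact ⟨ψ, fun ν => by simp [hψ, hl.2]⟩
  intro l
  induction l with
  | nil => exact ⟨.top, by simp [Holds]⟩
  | cons a l ih =>
    obtain ⟨ψ, hψ⟩ := ih
    exact ⟨.and (φ a) ψ, by simp [Holds, hψ]⟩

end QFFormula

/-- A predicate of valuations in the universe (not involving `nil`) is defined by a quantifier-free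
formula. -/
def QFDef (𝔸 : Atoms U) {V : Type} (P : (V → U) → Prop) : Prop :=
  ∃ Φ : QFFormula 𝔸 V, ∀ v : V → U, Φ.Holds (fun x => some (v x)) ↔ P v

namespace QFDef

variable {V W : Type}

theorem const (p : Prop) : QFDef 𝔸 (fun _ : V → U => p) := by
  by_cases h : p
  · exact ⟨.top, by simp [QFFormula.Holds, h]⟩
  · exact ⟨.neg .top, by simp [QFFormula.Holds, h]⟩

theorem not {P : (V → U) → Prop} (hP : QFDef 𝔸 P) : QFDef 𝔸 (fun v => ¬ P v) := by
  obtain ⟨Φ, h⟩ := hP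
  exact ⟨.neg Φ, by simp [QFFormula.Holds, h]⟩

theorem and {P P' : (V → U) → Prop} (hP : QFDef 𝔸 P) (hP' : QFDef 𝔸 P') :
    QFDef 𝔸 (fun v => P v ∧ P' v) := by
  obtain ⟨Φ, h⟩ := hP
  obtain ⟨Φ', h'⟩ := hP'
  exact ⟨.and Φ Φ', by simp [QFFormula.Holds, h, h']⟩

theorem imp {P P' : (V → U) → Prop} (hP : QFDef 𝔸 P) (hP' : QFDef 𝔸 P') :
    QFDef 𝔸 (fun v => P v → P' v) := by
  simpa only [← not_and_not_right] using (hP.and hP'.not).not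

theorem iff {P P' : (V → U) → Prop} (hP : QFDef 𝔸 P) (hP' : QFDef 𝔸 P') :
    QFDef 𝔸 (fun v => P v ↔ P' v) := by
  simpa only [← iff_def] using (hP.imp hP').and (hP'.imp hP)

theorem forall_finite {ι : Type*} [Finite ι] {P : ι → (V → U) → Prop} (hP : ∀ i, QFDef 𝔸 (P i)) :
    QFDef 𝔸 (fun v => ∀ i, P i v) := by
  choose Φ h using hP
  obtain ⟨ψ, hψ⟩ := QFFormula.exists_forall Φ
  exact ⟨ψ, fun v => by simp [hψ, h]⟩

theorem exists_finite {ι : Type*} [Finite ι] {P : ι → (V → U) → Prop} (hP : ∀ i, QFDef 𝔸 (P i)) :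
    QFDef 𝔸 (fun v => ∃ i, P i v) := by
  simpa only [not_forall, not_not] using (forall_finite fun i => (hP i).not).not

theorem comap (f : V → W) {P : (V → U) → Prop} (hP : QFDef 𝔸 P) :
    QFDef 𝔸 (fun v : W → U => P (v ∘ f)) := by
  obtain ⟨Φ, h⟩ := hP
  exact ⟨Φ.map f, fun v => by rw [QFFormula.holds_map]; exact h (v ∘ f)⟩

theorem eq (x y : V) : QFDef 𝔸 (fun v => v x = v y) :=
  ⟨QFFormula.eq 𝔸 x y, fun v => by simp [QFFormula.holds_eq, eq_comm]⟩

theorem rel (i : Fin 𝔸.numRel) (x : Fin (𝔸.arity i) → V) :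
    QFDef 𝔸 (fun v => 𝔸.rel i (fun j => v (x j))) := by
  refine ⟨.rel i x, fun v => ⟨?_, fun h => ⟨fun j => v (x j), fun _ => rfl, h⟩⟩⟩
  rintro ⟨a, ha, h⟩
  obtain rfl : a = fun j => v (x j) := funext fun j => (Option.some.inj (ha j)).symm
  exact h

end QFDef

/-! ### Tiling automata -/

/-- A register automaton that labels every position of a segment of a data word with a state and a
valuation of registers. `keep q q'` is the set of registers whose contents agree at neighbouring
positions labelled with `q` and `q'`. The local condition at a position depends on its state, letter,
register valuation, data value, and on a valuation of the parameters in `D`. -/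
structure Tiling (𝔸 : Atoms U) (Γ : Type v) (D : Type) where
  Q : Type v
  finite_Q : Finite Q
  nonempty_Q : Nonempty Q
  R : Type
  finite_R : Finite R
  first : Set Q
  last : Set Q
  next : Q → Q → Prop
  keep : Q → Q → Set R
  loc : Q → Γ → (R → U) → (D → U) → U → Prop
  loc_def : ∀ q γ, QFDef 𝔸 (fun v : R ⊕ (D ⊕ Unit) → U =>
    loc q γ (fun r => v (.inl r)) (fun x => v (.inr (.inl x))) (v (.inr (.inr ()))))

variable {Γ Γ' : Type v} {D : Type}

theorem Tiling.qfDef_loc (M : Tiling 𝔸 Γ D) {V : Type} (q : M.Q) (γ : Γ) (f : M.R → V) (h : D → V)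
    (x : V) : QFDef 𝔸 (fun v : V → U =>
      M.loc q γ (fun r => v (f r)) (fun y => v (h y)) (v x)) :=
  (M.loc_def q γ).comap (Sum.elim f (Sum.elim h fun _ => x))

/-- `q` and `μ` label the segment `[a, e)` of the word with letters `g` and data `α`. -/
structure Tiling.IsRun (M : Tiling 𝔸 Γ D) (g : ℕ → Γ) (α : ℕ → U) (d : D → U) (a e : ℕ)
    (q : ℕ → M.Q) (μ : ℕ → M.R → U) : Prop where
  first : q a ∈ M.first
  last : q (e - 1) ∈ M.last
  next : ∀ m, a ≤ m → m + 1 < e → M.next (q m) (q (m + 1))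
  keep : ∀ m, a ≤ m → m + 1 < e → ∀ r ∈ M.keep (q m) (q (m + 1)), μ m r = μ (m + 1) r
  loc : ∀ m, a ≤ m → m < e → M.loc (q m) (g m) (μ m) d (α m)

/-- Predicates of segments of data words with parameters. -/
abbrev SegPred (U : Type u) (Γ : Type v) (D : Type) : Type _ :=
  (ℕ → Γ) → (ℕ → U) → (D → U) → ℕ → ℕ → Prop

/-- Predicates of nonempty segments that are recognised by a tiling automaton. -/
def Rec (𝔸 : Atoms U) (P : SegPred U Γ D) : Prop :=
  ∃ M : Tiling 𝔸 Γ D, ∀ g α d a e, a < e →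
    (P g α d a e ↔ ∃ q μ, M.IsRun g α d a e q μ)

namespace Rec

theorem congr {P P' : SegPred U Γ D} (h : Rec 𝔸 P)
    (hP : ∀ g α d a e, a < e → (P' g α d a e ↔ P g α d a e)) : Rec 𝔸 P' := by
  obtain ⟨M, hM⟩ := h
  exact ⟨M, fun g α d a e hae => (hP g α d a e hae).trans (hM g α d a e hae)⟩

theorem local_all {p : Γ → (D → U) → U → Prop}
    (hp : ∀ γ, QFDef 𝔸 (fun v : D ⊕ Unit → U => p γ (fun x => v (.inl x)) (v (.inr ())))) :
    Rec 𝔸 (fun g α d a e => ∀ m, a ≤ m → m < e → p (g m) d (α m)) := by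
  refine ⟨⟨PUnit, inferInstance, inferInstance, Empty, inferInstance, Set.univ, Set.univ,
    fun _ _ => True, fun _ _ => ∅, fun _ γ _ d α => p γ d α, fun _ γ => (hp γ).comap Sum.inr⟩,
    fun g α d a e hae => ⟨fun h => ⟨fun _ => ⟨⟩, fun _ => Empty.elim, ⟨trivial, trivial,
      fun _ _ _ => trivial, fun _ _ _ r => r.elim, h⟩⟩, ?_⟩⟩
  rintro ⟨q, μ, h⟩
  exact h.loc

theorem const (p : Prop) : Rec 𝔸 (fun (_ : ℕ → Γ) _ (_ : D → U) _ _ => p) :=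
  (local_all (p := fun _ _ _ => p) fun _ => .const p).congr fun _ _ _ a _ h =>
    ⟨fun hp _ _ _ => hp, fun H => H a le_rfl h⟩

theorem forall_fin {N : ℕ} {P : Fin N → SegPred U Γ D} (h : ∀ i, Rec 𝔸 (P i)) :
    Rec 𝔸 (fun g α d a e => ∀ i, P i g α d a e) := by
  choose M hM using h
  have _ (i) := (M i).finite_Q
  have _ (i) := (M i).nonempty_Q
  have _ (i) := (M i).finite_R
  refine ⟨⟨∀ i, (M i).Q, inferInstance, inferInstance, Σ i, (M i).R, inferInstance,
    {q | ∀ i, q i ∈ (M i).first}, {q | ∀ i, q i ∈ (M i).last},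
    fun q q' => ∀ i, (M i).next (q i) (q' i),
    fun q q' => {r | r.2 ∈ (M r.1).keep (q r.1) (q' r.1)},
    fun q γ μ d α => ∀ i, (M i).loc (q i) γ (fun r => μ ⟨i, r⟩) d α, fun q γ => .forall_finite
      fun i => (M i).qfDef_loc (q i) γ (fun r => Sum.inl (⟨i, r⟩ : Σ i, (M i).R))
        (fun x => Sum.inr (Sum.inl x)) _⟩, ?_⟩
  intro g α d a e hae
  simp only [hM _ _ _ _ _ _ hae]
  constructor
  · intro h
    choose q μ h using h
    exact ⟨fun m i => q i m, fun m r => μ r.1 m r.2, fun i => (h i).first, fun i => (h i).last,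
      fun m h1 h2 i => (h i).next m h1 h2, fun m h1 h2 r hr => (h r.1).keep m h1 h2 r.2 hr,
      fun m h1 h2 i => (h i).loc m h1 h2⟩
  · rintro ⟨q, μ, h⟩ i
    exact ⟨fun m => q m i, fun m r => μ m ⟨i, r⟩, h.first i, h.last i,
      fun m h1 h2 => h.next m h1 h2 i, fun m h1 h2 r hr => h.keep m h1 h2 ⟨i, r⟩ hr,
      fun m h1 h2 => h.loc m h1 h2 i⟩

theorem exists_fin [Nonempty U] {N : ℕ} {P : Fin N → SegPred U Γ D} (h : ∀ i, Rec 𝔸 (P i)) :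
    Rec 𝔸 (fun g α d a e => ∃ i, P i g α d a e) := by
  classical
  -- The case `N = 0` is separate because a union of no automata would have no state.
  rcases N with _ | N
  · exact (const False).congr fun _ _ _ _ _ _ => by simp
  choose M hM using h
  have _ (i) := (M i).finite_Q
  have _ (i) := (M i).nonempty_Q
  have _ (i) := (M i).finite_R
  refine ⟨⟨Fin (N + 1) × ∀ i, (M i).Q, inferInstance, inferInstance, Σ i, (M i).R, inferInstance,
    {q | q.2 q.1 ∈ (M q.1).first}, {q | q.2 q.1 ∈ (M q.1).last},
    fun q q' => q.1 = q'.1 ∧ (M q.1).next (q.2 q.1) (q'.2 q.1),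
    fun q q' => {r | r.1 = q.1 ∧ r.2 ∈ (M r.1).keep (q.2 r.1) (q'.2 r.1)},
    fun q γ μ d α => (M q.1).loc (q.2 q.1) γ (fun r => μ ⟨q.1, r⟩) d α, fun q γ =>
      (M q.1).qfDef_loc (q.2 q.1) γ (fun r => Sum.inl (⟨q.1, r⟩ : Σ i, (M i).R))
        (fun x => Sum.inr (Sum.inl x)) _⟩, ?_⟩
  intro g α d a e hae
  simp only [hM _ _ _ _ _ _ hae]
  constructor
  · rintro ⟨i, q, μ, h⟩
    let q₀ (j) : (M j).Q := Classical.arbitrary _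
    -- States and registers of the components that were not chosen are irrelevant and filled
    -- arbitrarily.
    refine ⟨fun m => (i, Function.update q₀ i (q m)),
      fun m r => if hr : r.1 = i then μ m (hr ▸ r.2) else Classical.arbitrary U, ?_, ?_, ?_, ?_, ?_⟩
    · simpa using h.first
    · simpa using h.last
    · intro m h1 h2
      simpa using h.next m h1 h2
    · rintro m h1 h2 ⟨j, r⟩ ⟨hr1, hr2⟩
      obtain rfl : j = i := hr1
      simpa using h.keep m h1 h2 r (by simpa using hr2)
    · intro m h1 h2
      simpa using h.loc m h1 h2
  · rintro ⟨q, μ, h⟩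
    have hc : ∀ m, a ≤ m → m < e → (q m).1 = (q a).1 := by
      intro m hm
      induction m, hm using Nat.le_induction with
      | base => exact fun _ => rfl
      | succ m hm ih => exact fun hme => (h.next m hm hme).1.symm.trans (ih (by omega))
    refine ⟨(q a).1, fun m => (q m).2 (q a).1, fun m r => μ m ⟨(q a).1, r⟩, h.first, ?_, ?_, ?_, ?_⟩
    · have := h.last
      rw [Set.mem_ofPred_eq, hc (e - 1) (by omega) (by omega)] at this
      exact this
    · intro m h1 h2
      have := (h.next m h1 h2).2
      rwa [hc m h1 (by omega)] at this
    · intro m h1 h2 r hr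
      exact h.keep m h1 h2 ⟨_, r⟩ ⟨(hc m h1 (by omega)).symm, hr⟩
    · intro m h1 h2
      have := h.loc m h1 h2
      dsimp only at this
      rwa [hc m h1 h2] at this

theorem forall_finite {ι : Type*} [Finite ι] {P : ι → SegPred U Γ D} (h : ∀ i, Rec 𝔸 (P i)) :
    Rec 𝔸 (fun g α d a e => ∀ i, P i g α d a e) :=
  (forall_fin fun i => h ((Finite.equivFin ι).symm i)).congr fun g α d a e _ =>
    ⟨fun H i => H _, fun H i => by simpa using H (Finite.equivFin ι i)⟩

theorem exists_finite [Nonempty U] {ι : Type*} [Finite ι] {P : ι → SegPred U Γ D}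
    (h : ∀ i, Rec 𝔸 (P i)) : Rec 𝔸 (fun g α d a e => ∃ i, P i g α d a e) :=
  (exists_fin fun i => h ((Finite.equivFin ι).symm i)).congr fun g α d a e _ =>
    ⟨fun ⟨i, hi⟩ => ⟨Finite.equivFin ι i, by simpa using hi⟩, fun ⟨i, hi⟩ => ⟨_, hi⟩⟩

theorem and {P P' : SegPred U Γ D} (h : Rec 𝔸 P) (h' : Rec 𝔸 P') :
    Rec 𝔸 (fun g α d a e => P g α d a e ∧ P' g α d a e) :=
  (forall_finite (P := fun b : Bool => cond b P P') (by rintro (_ | _) <;> assumption)).congr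
    fun _ _ _ _ _ _ => by simp [and_comm]

theorem or [Nonempty U] {P P' : SegPred U Γ D} (h : Rec 𝔸 P) (h' : Rec 𝔸 P') :
    Rec 𝔸 (fun g α d a e => P g α d a e ∨ P' g α d a e) :=
  (exists_finite (P := fun b : Bool => cond b P P') (by rintro (_ | _) <;> assumption)).congr
    fun _ _ _ _ _ _ => by simp [or_comm]

end Rec

/-! ### Quantifiers, scopes and complementation for tiling automata -/

namespace Rec

/-- The conditions force the pattern `0 … 0 1 2 … 2`, so the phases mark exactly one position `p`:
before, at, and after it. -/
theorem exists_phase_change (s : ℕ → Fin 3) {a e : ℕ} (hae : a < e) (h0 : s a ≠ 2)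
    (hs : ∀ m, a ≤ m → m + 1 < e → (s m = 0 ∧ s (m + 1) ≠ 2 ∨ s m ≠ 0 ∧ s (m + 1) = 2))
    (hl : s (e - 1) ≠ 0) :
    ∃ p, a ≤ p ∧ p < e ∧ ∀ m, a ≤ m → m < e → ((s m = 0) = (m < p)) ∧ ((s m = 1) = (m = p)) := by
  classical
  have hex : ∃ p, a ≤ p ∧ s p ≠ 0 := ⟨e - 1, by omega, hl⟩
  have hp1 := Nat.find_spec hex
  have hp2 : ∀ m, a ≤ m → m < Nat.find hex → s m = 0 := fun m h1 h2 => by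
    by_contra h
    exact Nat.find_min hex h2 ⟨h1, h⟩
  have hpe : Nat.find hex ≤ e - 1 := Nat.find_min' hex ⟨by omega, hl⟩
  generalize Nat.find hex = p at *
  have hp3 : s p = 1 := by
    have : s p ≠ 2 := by
      by_cases hpa : p = a
      · rwa [hpa]
      · have h1 := hs (p - 1) (by omega) (by omega)
        rw [show p - 1 + 1 = p by omega] at h1
        rcases h1 with h1 | h1
        · exact h1.2
        · exact (h1.1 (hp2 _ (by omega) (by omega))).elim
    have := hp1.2
    omega
  have hp4 : ∀ m, p < m → m < e → s m = 2 := by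
    intro m hm
    induction m, hm using Nat.le_induction with
    | base =>
      intro h
      rcases hs p hp1.1 h with h1 | h1
      · exact (hp1.2 h1.1).elim
      · exact h1.2
    | succ m hm ih =>
      intro h
      have := ih (by omega)
      rcases hs m (by omega) h with h1 | h1
      · rw [h1.1] at this; simp at this
      · exact h1.2
  refine ⟨p, hp1.1, by omega, fun m h1 h2 => ?_⟩
  rcases lt_trichotomy m p with h | h | h
  · simp [hp2 m h1 h, h, h.ne]
  · simp [h, hp3]
  · simp [hp4 m h h2, h.not_gt, h.ne']

/-- A phase in the state marks `p` and supplies the two comparisons with `p`. The additional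
register `none` is kept throughout the segment; it supplies the new parameter at every position and
is compared with the data value at `p`. This is where a value is guessed before it is read. -/
theorem ex {k : ℕ} {P : SegPred U Γ' (Fin (k + 1))} (h : Rec 𝔸 P) (f : Γ → Prop → Prop → Γ')
    (γ₀ : Γ) : Rec 𝔸 (fun g α (d : Fin k → U) a e => ∃ p, a ≤ p ∧ p < e ∧ g p = γ₀ ∧
      P (fun m => f (g m) (m < p) (m = p)) α (Fin.cons (α p) d) a e) := by
  obtain ⟨M, hM⟩ := h
  have _ := M.finite_Q
  have _ := M.nonempty_Q
  have _ := M.finite_R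
  refine ⟨⟨M.Q × Fin 3, inferInstance, inferInstance, Option M.R, inferInstance,
    {q | q.1 ∈ M.first ∧ q.2 ≠ 2}, {q | q.1 ∈ M.last ∧ q.2 ≠ 0},
    fun q q' => M.next q.1 q'.1 ∧ (q.2 = 0 ∧ q'.2 ≠ 2 ∨ q.2 ≠ 0 ∧ q'.2 = 2),
    fun q q' => {r | ∀ r', r = some r' → r' ∈ M.keep q.1 q'.1},
    fun q γ μ d α => (q.2 = 1 → γ = γ₀ ∧ α = μ none) ∧
      M.loc q.1 (f γ (q.2 = 0) (q.2 = 1)) (fun r => μ (some r)) (Fin.cons (μ none) d) α,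
    fun q γ => ?_⟩, ?_⟩
  · refine ((QFDef.const _).imp ((QFDef.const _).and (.eq _ _))).and ?_
    convert M.qfDef_loc (V := Option M.R ⊕ (Fin k ⊕ Unit)) q.1 (f γ (q.2 = 0) (q.2 = 1))
      (fun r => Sum.inl (some r))
      (Fin.cons (Sum.inl none) (fun x => Sum.inr (Sum.inl x))) (Sum.inr (Sum.inr ())) using 3
    funext y
    refine Fin.cases ?_ (fun y => ?_) y <;> simp
  intro g α d a e hae
  constructor
  · rintro ⟨p, hp1, hp2, hp3, hP⟩
    obtain ⟨q, μ, hr⟩ := (hM _ _ _ _ _ hae).1 hP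
    refine ⟨fun m => (q m, if m < p then 0 else if m = p then 1 else 2),
      fun m r => r.elim (α p) (μ m), ⟨hr.first, ?_⟩, ⟨hr.last, ?_⟩, fun m h1 h2 =>
        ⟨hr.next m h1 h2, ?_⟩, ?_, ?_⟩
    · dsimp only
      split_ifs <;> omega
    · dsimp only
      split_ifs <;> omega
    · dsimp only
      split_ifs <;> omega
    · rintro m h1 h2 (_ | r) hkeep
      · rfl
      · exact hr.keep m h1 h2 r (hkeep r rfl)
    · intro m h1 h2
      have := hr.loc m h1 h2
      dsimp only [Option.elim]
      rcases lt_trichotomy m p with h | h | h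
      · simpa [h, h.ne] using this
      · subst h
        simpa [hp3] using this
      · simpa [h.not_gt, h.ne'] using this
  · rintro ⟨q, μ, hr⟩
    have hμ : ∀ m, a ≤ m → m < e → μ m none = μ a none := by
      intro m hm
      induction m, hm using Nat.le_induction with
      | base => exact fun _ => rfl
      | succ m hm ih =>
        exact fun hme => (hr.keep m hm hme none (by simp)).symm.trans (ih (by omega))
    obtain ⟨p, h1, h2, h3⟩ := exists_phase_change (fun m => (q m).2) hae hr.first.2
      (fun m h1 h2 => (hr.next m h1 h2).2) hr.last.2
    have hl := (hr.loc p h1 h2).1 ((h3 p h1 h2).2.mpr rfl)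
    refine ⟨p, h1, h2, hl.1, (hM _ _ _ _ _ hae).2 ⟨fun m => (q m).1, fun m r => μ m (some r),
      hr.first.1, hr.last.1, fun m h1 h2 => (hr.next m h1 h2).1, fun m h1 h2 r hkeep =>
        hr.keep m h1 h2 (some r) (by rintro _ ⟨⟩; exact hkeep), fun m hm1 hm2 => ?_⟩⟩
    have := (hr.loc m hm1 hm2).2
    rw [hμ m hm1 hm2, ← hμ p h1 h2, ← hl.2] at this
    simpa only [(h3 m hm1 hm2).1, (h3 m hm1 hm2).2] using this

theorem exSet {P : SegPred U Γ' D} (h : Rec 𝔸 P) (f : Γ → Prop → Γ') :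
    Rec 𝔸 (fun g α d a e => ∃ X ⊆ Set.Ico a e, P (fun m => f (g m) (m ∈ X)) α d a e) := by
  obtain ⟨M, hM⟩ := h
  have _ := M.finite_Q
  have _ := M.nonempty_Q
  refine ⟨⟨M.Q × Prop, inferInstance, inferInstance, M.R, M.finite_R,
    {q | q.1 ∈ M.first}, {q | q.1 ∈ M.last}, fun q q' => M.next q.1 q'.1,
    fun q q' => M.keep q.1 q'.1, fun q γ μ d α => M.loc q.1 (f γ q.2) μ d α,
    fun q γ => M.loc_def q.1 (f γ q.2)⟩, ?_⟩
  intro g α d a e hae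
  simp only [hM _ _ _ _ _ hae]
  constructor
  · rintro ⟨X, -, q, μ, hr⟩
    exact ⟨fun m => (q m, m ∈ X), μ, hr.first, hr.last, hr.next, hr.keep, hr.loc⟩
  · rintro ⟨q, μ, hr⟩
    refine ⟨{m | (a ≤ m ∧ m < e) ∧ (q m).2}, fun m hm => hm.1, fun m => (q m).1, μ, hr.first,
      hr.last, hr.next, hr.keep, fun m h1 h2 => ?_⟩
    simpa [h1, h2] using hr.loc m h1 h2

/-- Runs on the subscopes are concatenated: at a cut, the transition and register conditions are
replaced by the conditions for ending one run and starting another. The relation `next` does not see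
letters, so the state records whether its position is a cut. -/
theorem seg {P : SegPred U Γ D} (h : Rec 𝔸 P) (c : Γ → Prop) :
    Rec 𝔸 (fun g α d a e => ∀ J ∈ subs (a, e) {m | c (g m)}, P g α d J.1 J.2) := by
  classical
  obtain ⟨M, hM⟩ := h
  have _ := M.finite_Q
  have _ := M.nonempty_Q
  refine ⟨⟨M.Q × Prop, inferInstance, inferInstance, M.R, M.finite_R,
    {q | q.1 ∈ M.first}, {q | q.1 ∈ M.last},
    fun q q' => if q'.2 then q.1 ∈ M.last ∧ q'.1 ∈ M.first else M.next q.1 q'.1,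
    fun q q' => if q'.2 then ∅ else M.keep q.1 q'.1,
    fun q γ μ d α => (q.2 ↔ c γ) ∧ M.loc q.1 γ μ d α,
    fun q γ => (QFDef.const _).and (M.loc_def q.1 γ)⟩, ?_⟩
  intro g α d a e hae
  have hsubs (J : Scope) := mem_subs_iff (I := (a, e)) (J := J) hae.le (X := {m | c (g m)})
  constructor
  · intro h
    have hJ (m : ℕ) : ∃ J : Scope, a ≤ m → m < e →
        J ∈ subs (a, e) {m | c (g m)} ∧ J.1 ≤ m ∧ m < J.2 := by
      by_cases hm : a ≤ m ∧ m < e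
      · obtain ⟨J, h1, h2⟩ := exists_mem_subs (I := (a, e)) {m | c (g m)} hm.1 hm.2
        exact ⟨J, fun _ _ => ⟨h1, h2⟩⟩
      · exact ⟨(0, 0), fun h1 h2 => (hm ⟨h1, h2⟩).elim⟩
    choose J hJ using hJ
    have hrun (J : Scope) : ∃ (q : ℕ → M.Q) (μ : ℕ → M.R → U),
        J ∈ subs (a, e) {m | c (g m)} → M.IsRun g α d J.1 J.2 q μ := by
      by_cases hm : J ∈ subs (a, e) {m | c (g m)}
      · obtain ⟨q, μ, hr⟩ := (hM _ _ _ _ _ ((hsubs J).1 hm).2.1).1 (h J hm)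
        exact ⟨q, μ, fun _ => hr⟩
      -- The value for other pairs is irrelevant; a run on the first subscope serves, since states
      -- and data values are then at hand.
      · obtain ⟨J', hJ', -⟩ := exists_mem_subs (I := (a, e)) {m | c (g m)} le_rfl hae
        obtain ⟨q, μ, hr⟩ := (hM _ _ _ _ _ ((hsubs J').1 hJ').2.1).1 (h J' hJ')
        exact ⟨q, μ, fun h => (hm h).elim⟩
    choose q μ hr using hrun
    have hcut : ∀ m, a ≤ m → m + 1 < e → c (g (m + 1)) →
        (J m).2 = m + 1 ∧ (J (m + 1)).1 = m + 1 := by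
      intro m h1 h2 h3
      obtain ⟨h4, h5, h6⟩ := hJ m h1 (by omega)
      obtain ⟨h7, h8, h9⟩ := hJ (m + 1) (by omega) h2
      have h10 := ((hsubs _).1 h4).2.2.2.2.2 (m + 1)
      have h11 := ((hsubs _).1 h7).2.2.2.2.2 (m + 1)
      exact ⟨by by_contra; exact h10 (by omega) (by omega) h3,
        by by_contra; exact h11 (by omega) (by omega) h3⟩
    have hsame : ∀ m, a ≤ m → m + 1 < e → ¬ c (g (m + 1)) →
        J (m + 1) = J m ∧ m + 1 < (J m).2 := by
      intro m h1 h2 h3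
      obtain ⟨h4, h5, h6⟩ := hJ m h1 (by omega)
      obtain ⟨h7, h8, h9⟩ := hJ (m + 1) (by omega) h2
      obtain ⟨i1, i2, i3, i4, i5, i6⟩ := (hsubs _).1 h4
      obtain ⟨j1, j2, j3, j4, j5, j6⟩ := (hsubs _).1 h7
      dsimp only at *
      have k1 : (J m).2 ≠ m + 1 := by
        intro h
        rcases i5 with i5 | i5
        · omega
        · rw [h] at i5; exact h3 i5
      have k2 : (J (m + 1)).1 ≠ m + 1 := by
        intro h
        rcases j4 with j4 | j4
        · omega
        · rw [h] at j4; exact h3 j4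
      have k3 : (J m).1 = (J (m + 1)).1 := by
        rcases lt_trichotomy (J m).1 (J (m + 1)).1 with h | h | h
        · rcases j4 with j4 | j4
          · omega
          · exact (i6 _ h (by omega) j4).elim
        · exact h
        · rcases i4 with i4 | i4
          · omega
          · exact (j6 _ h (by omega) i4).elim
      have k4 : (J m).2 = (J (m + 1)).2 := by
        rcases lt_trichotomy (J m).2 (J (m + 1)).2 with h | h | h
        · rcases i5 with i5 | i5
          · omega
          · exact (j6 _ (by omega) h i5).elim
        · exact h
        · rcases j5 with j5 | j5
          · omega
          · exact (i6 _ (by omega) h j5).elim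
      exact ⟨Prod.ext k3.symm k4.symm, by omega⟩
    refine ⟨fun m => (q (J m) m, c (g m)), fun m => μ (J m) m, ?_, ?_, ?_, ?_, ?_⟩
    · obtain ⟨h1, h2, h3⟩ := hJ a le_rfl hae
      have h4 := (hr _ h1).first
      have h5 := ((hsubs _).1 h1).1
      rwa [show (J a).1 = a from le_antisymm h2 h5] at h4
    · obtain ⟨h1, h2, h3⟩ := hJ (e - 1) (by omega) (by omega)
      have h4 := (hr _ h1).last
      have h5 := ((hsubs _).1 h1).2.2.1
      dsimp only at h5
      rwa [show (J (e - 1)).2 = e by omega] at h4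
    · intro m h1 h2
      dsimp only
      obtain ⟨h3, -⟩ := hJ m h1 (by omega)
      obtain ⟨h4, -⟩ := hJ (m + 1) (by omega) h2
      split_ifs with hc
      · obtain ⟨h5, h6⟩ := hcut m h1 h2 hc
        have h7 := (hr _ h3).last
        have h8 := (hr _ h4).first
        rw [h5] at h7
        rw [h6] at h8
        exact ⟨h7, h8⟩
      · obtain ⟨h5, h6⟩ := hsame m h1 h2 hc
        rw [h5]
        exact (hr _ h3).next m (hJ m h1 (by omega)).2.1 h6
    · intro m h1 h2
      dsimp only
      obtain ⟨h3, -⟩ := hJ m h1 (by omega)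
      split_ifs with hc
      · simp
      · obtain ⟨h5, h6⟩ := hsame m h1 h2 hc
        rw [h5]
        exact (hr _ h3).keep m (hJ m h1 (by omega)).2.1 h6
    · intro m h1 h2
      obtain ⟨h3, h4, h5⟩ := hJ m h1 h2
      exact ⟨Iff.rfl, (hr _ h3).loc m h4 h5⟩
  · rintro ⟨q, μ, hr⟩ J hJ
    obtain ⟨h1, h2, h3, h4, h5, h6⟩ := (hsubs J).1 hJ
    dsimp only at h1 h3 h4 h5
    have hn : ∀ m, J.1 ≤ m → m + 1 < J.2 → ¬ (q (m + 1)).2 := fun m k1 k2 k3 =>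
      h6 _ (by omega) k2 ((hr.loc (m + 1) (by omega) (by omega)).1.1 k3)
    refine (hM _ _ _ _ _ h2).2 ⟨fun m => (q m).1, μ, ?_, ?_, fun m k1 k2 => ?_, fun m k1 k2 => ?_,
      fun m k1 k2 => (hr.loc m (by omega) (by omega)).2⟩
    · by_cases ha : J.1 = a
      · rw [ha]; exact hr.first
      · have k1 := hr.next (J.1 - 1) (by omega) (by omega)
        dsimp only at k1
        rw [show J.1 - 1 + 1 = J.1 by omega, if_pos] at k1
        · exact k1.2
        · exact (hr.loc J.1 (by omega) (by omega)).1.2 (h4.resolve_left ha)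
    · by_cases ha : J.2 = e
      · rw [ha]; exact hr.last
      · have k1 := hr.next (J.2 - 1) (by omega) (by omega)
        dsimp only at k1
        rw [show J.2 - 1 + 1 = J.2 by omega, if_pos] at k1
        · exact k1.1
        · exact (hr.loc J.2 (by omega) (by omega)).1.2 (h5.resolve_left ha)
    · have := hr.next m (by omega) (by omega)
      dsimp only at this
      rwa [if_neg (hn m k1 k2)] at this
    · have := hr.keep m (by omega) (by omega)
      dsimp only at this
      rwa [if_neg (hn m k1 k2)] at this

/-- Complementation of predicates that do not involve data, by determinization. -/
theorem compl [Finite Γ] {𝔸 : Atoms PUnit.{1}} {P : SegPred PUnit.{1} Γ D} (h : Rec 𝔸 P) :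
    Rec 𝔸 (fun g α d a e => ¬ P g α d a e) := by
  obtain ⟨M, hM⟩ := h
  have _ := M.finite_Q
  let step (S : Set M.Q) (γ : Γ) : Set M.Q :=
    {q' | ∃ q ∈ S, M.loc q γ (fun _ => ⟨⟩) (fun _ => ⟨⟩) ⟨⟩ ∧ M.next q q'}
  -- The set holds the states reachable at a position before its local condition is checked. The
  -- letter is stored with it because `next` and `last` do not see letters; `Option` keeps the state
  -- space inhabited even over an empty alphabet.
  refine ⟨⟨Set M.Q × Option Γ, inferInstance, inferInstance, Empty, inferInstance,
    {s | s.1 = M.first},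
    {s | ∀ γ, s.2 = some γ → ∀ q ∈ s.1, M.loc q γ (fun _ => ⟨⟩) (fun _ => ⟨⟩) ⟨⟩ → q ∉ M.last},
    fun s s' => ∀ γ, s.2 = some γ → s'.1 = step s.1 γ,
    fun _ _ => ∅, fun s γ _ _ _ => s.2 = some γ, fun s γ => .const _⟩, ?_⟩
  intro g α d a e hae
  beta_reduce
  rw [hM _ _ _ _ _ hae]
  let reach (m : ℕ) : Set M.Q := {x | ∃ q : ℕ → M.Q, q a ∈ M.first ∧ q m = x ∧ ∀ m', a ≤ m' →
    m' < m → M.loc (q m') (g m') (fun _ => ⟨⟩) (fun _ => ⟨⟩) ⟨⟩ ∧ M.next (q m') (q (m' + 1))}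
  have reach_zero : reach a = M.first := by
    ext x
    constructor
    · rintro ⟨q, h1, rfl, -⟩
      exact h1
    · intro h
      exact ⟨fun _ => x, h, rfl, fun m' h1 h2 => by omega⟩
  have reach_succ : ∀ m, a ≤ m → reach (m + 1) = step (reach m) (g m) := by
    intro m hm
    ext x
    constructor
    · rintro ⟨q, h1, rfl, h2⟩
      exact ⟨q m, ⟨q, h1, rfl, fun m' h3 h4 => h2 m' h3 (by omega)⟩, h2 m hm (by omega)⟩
    · rintro ⟨y, ⟨q, h1, rfl, h2⟩, h3⟩
      refine ⟨fun m' => if m' ≤ m then q m' else x, by simpa [hm] using h1, by simp,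
        fun m' h4 h5 => ?_⟩
      by_cases h6 : m' = m
      · subst h6
        simpa using h3
      · have h7 : m' + 1 ≤ m := by omega
        have h8 : m' ≤ m := by omega
        simpa [h7, h8] using h2 m' h4 (by omega)
  constructor
  · intro h
    refine ⟨fun m => (reach m, some (g m)), fun _ => Empty.elim, reach_zero, ?_, ?_,
      fun _ _ _ r => r.elim, fun _ _ _ => rfl⟩
    · rintro γ hγ x ⟨q, h1, rfl, h2⟩ h3 h4
      obtain rfl : g (e - 1) = γ := Option.some.inj hγ
      refine h ⟨q, fun _ _ => ⟨⟩, h1, h4, fun m h5 h6 => (h2 m h5 (by omega)).2,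
        fun _ _ _ _ _ => rfl, fun m h5 h6 => ?_⟩
      by_cases h7 : m = e - 1
      · subst h7; exact h3
      · exact (h2 m h5 (by omega)).1
    · rintro m h1 h2 γ hγ
      obtain rfl : g m = γ := Option.some.inj hγ
      exact reach_succ m h1
  · rintro ⟨s, μ, hs⟩ ⟨q, μ', hr⟩
    have hreach : ∀ m, a ≤ m → m < e → (s m).1 = reach m := by
      intro m hm
      induction m, hm using Nat.le_induction with
      | base => exact fun _ => hs.first.trans reach_zero.symm
      | succ m hm ih =>
        intro hme
        rw [hs.next m hm hme _ (hs.loc m hm (by omega)), ih (by omega), reach_succ m hm]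
    refine hs.last _ (hs.loc (e - 1) (by omega) (by omega)) (q (e - 1)) ?_
      (hr.loc (e - 1) (by omega) (by omega)) hr.last
    rw [hreach (e - 1) (by omega) (by omega)]
    exact ⟨q, hr.first, rfl, fun m h1 h2 =>
      ⟨hr.loc m h1 (by omega), hr.next m h1 (by omega)⟩⟩

/-- A predicate that does not involve data, of words whose letters are extended by definable
properties of the data. -/
theorem of_definable_letters {B : Type*} [Finite B] (bit : U → (D → U) → B)
    (hbit : ∀ b, QFDef 𝔸 (fun v : D ⊕ Unit → U => bit (v (.inr ())) (fun x => v (.inl x)) = b))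
    {𝔸' : Atoms PUnit.{1}} {P : SegPred PUnit.{1} Γ' D} (h : Rec 𝔸' P) (f : Γ → B → Γ') :
    Rec 𝔸 (fun g α d a e =>
      P (fun m => f (g m) (bit (α m) d)) (fun _ => ⟨⟩) (fun _ => ⟨⟩) a e) := by
  obtain ⟨M, hM⟩ := h
  refine ⟨⟨M.Q, M.finite_Q, M.nonempty_Q, Empty, inferInstance, M.first, M.last, M.next,
    fun _ _ => ∅, fun q γ μ d α => ∃ b, bit α d = b ∧
      M.loc q (f γ b) (fun _ => ⟨⟩) (fun _ => ⟨⟩) ⟨⟩,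
    fun q γ => .exists_finite fun b => .and ((hbit b).comap Sum.inr) (.const _)⟩, ?_⟩
  intro g α d a e hae
  beta_reduce
  rw [hM _ _ _ _ _ hae]
  constructor
  · rintro ⟨q, μ, hr⟩
    exact ⟨q, fun _ => Empty.elim, hr.first, hr.last, hr.next, fun _ _ _ r => r.elim,
      fun m h1 h2 => ⟨_, rfl, hr.loc m h1 h2⟩⟩
  · rintro ⟨q, μ, hr⟩
    refine ⟨q, fun _ _ => ⟨⟩, hr.first, hr.last, hr.next, fun _ _ _ _ _ => rfl,
      fun m h1 h2 => ?_⟩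
    obtain ⟨b, rfl, h⟩ := hr.loc m h1 h2
    exact h

end Rec

/-! ### Recognizable predicates of data words with valuations -/

section Recognizable

variable {S : Type v} {k l : ℕ}

/-- What is seen of a valuation of `k` first-order and `l` second-order variables at a position: the
letter, the sets that contain the position, and its comparison to the first-order variables. -/
abbrev Letter (S : Type v) (k l : ℕ) : Type v := S × (Fin l → Prop) × (Fin k → Prop × Prop)

/-- The letters of the first-order variables, their membership in sets, and their order. -/
abbrev Profile (S : Type v) (k l : ℕ) : Type v :=
  (Fin k → S) × (Fin k → Fin l → Prop) × (Fin k → Fin k → Prop)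

/-- The letter of a valuation at the position `m`. -/
def encode (w : ℕ → S × U) (ν : Fin k → ℕ) (V : Fin l → Set ℕ) (m : ℕ) : Letter S k l :=
  ((w m).1, fun X => m ∈ V X, fun x => (m < ν x, m = ν x))

/-- The profile of a valuation. -/
def profile (w : ℕ → S × U) (ν : Fin k → ℕ) (V : Fin l → Set ℕ) : Profile S k l :=
  (fun x => (w (ν x)).1, fun x X => ν x ∈ V X, fun x y => ν x < ν y)

/-- The letter after a first-order variable has been added. -/
def Letter.addVar (γ : Letter S k l) (b c : Prop) : Letter S (k + 1) l :=
  (γ.1, γ.2.1, Fin.cons (b, c) γ.2.2)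

/-- The letter after a second-order variable has been added. -/
def Letter.addSet (γ : Letter S k l) (b : Prop) : Letter S k (l + 1) :=
  (γ.1, Fin.cons b γ.2.1, γ.2.2)

/-- The profile after adding a first-order variable for a position with letter `γ`. -/
def Profile.addVar (τ : Profile S k l) (γ : Letter S k l) : Profile S (k + 1) l :=
  (Fin.cons γ.1 τ.1, Fin.cons γ.2.1 τ.2.1, Fin.cons (Fin.cons False fun x => (γ.2.2 x).1)
    fun x => Fin.cons (¬ (γ.2.2 x).1 ∧ ¬ (γ.2.2 x).2) (τ.2.2 x))

/-- The profile after adding a set that contains the first-order variables in `t`. -/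
def Profile.addSet (τ : Profile S k l) (t : Fin k → Prop) : Profile S k (l + 1) :=
  (τ.1, fun x => Fin.cons (t x) (τ.2.1 x), τ.2.2)

theorem encode_cons_var (w : ℕ → S × U) (p : ℕ) (ν : Fin k → ℕ) (V : Fin l → Set ℕ) :
    encode w (Fin.cons p ν : Fin (k + 1) → ℕ) V =
      fun m => (encode w ν V m).addVar (m < p) (m = p) := by
  funext m
  refine Prod.ext rfl (Prod.ext rfl (funext fun x => ?_))
  refine Fin.cases ?_ (fun x => ?_) x <;> simp [encode, Letter.addVar]

theorem encode_cons_set (w : ℕ → S × U) (P : Set ℕ) (ν : Fin k → ℕ) (V : Fin l → Set ℕ) :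
    encode w ν (Fin.cons P V : Fin (l + 1) → Set ℕ) =
      fun m => (encode w ν V m).addSet (m ∈ P) := by
  funext m
  refine Prod.ext rfl (Prod.ext (funext fun x => ?_) rfl)
  refine Fin.cases ?_ (fun x => ?_) x <;> simp [encode, Letter.addSet]

/-- A free variable may lie outside the scope, where a tiling cannot see it; the profile supplies
what is known of it. The letter at `p` already contains the sets around `p` and the comparisons of
`p` with older variables, so choosing this letter determines the new profile. -/
theorem profile_cons_var (w : ℕ → S × U) (p : ℕ) (ν : Fin k → ℕ) (V : Fin l → Set ℕ) :
    profile w (Fin.cons p ν : Fin (k + 1) → ℕ) V = (profile w ν V).addVar (encode w ν V p) := by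
  refine Prod.ext (funext fun x => ?_) (Prod.ext (funext fun x => ?_) (funext fun x => ?_))
  · refine Fin.cases ?_ (fun x => ?_) x <;> simp [encode, profile, Profile.addVar]
  · refine Fin.cases ?_ (fun x => ?_) x <;> simp [encode, profile, Profile.addVar]
  · funext y
    refine Fin.cases ?_ (fun x => ?_) x <;> refine Fin.cases ?_ (fun y => ?_) y <;>
      simp [encode, profile, Profile.addVar]
    omega

theorem profile_cons_set (w : ℕ → S × U) (P : Set ℕ) (ν : Fin k → ℕ) (V : Fin l → Set ℕ) :
    profile w ν (Fin.cons P V : Fin (l + 1) → Set ℕ) =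
      (profile w ν V).addSet (fun x => ν x ∈ P) := by
  refine Prod.ext rfl (Prod.ext (funext fun x => funext fun X => ?_) rfl)
  refine Fin.cases ?_ (fun X => ?_) X <;> simp [profile, Profile.addSet]

/-- Predicates of infinite data words with valuations, in a scope. -/
abbrev WordPred (U : Type u) (S : Type v) (k l : ℕ) : Type _ :=
  (ℕ → S × U) → (Fin k → ℕ) → (Fin l → Set ℕ) → Scope → Prop

/-- Recognizability in nonempty scopes, for every profile separately. -/
def Recognizable (𝔸 : Atoms U) (P : WordPred U S k l) : Prop :=
  ∃ M : Profile S k l → SegPred U (Letter S k l) (Fin k), (∀ τ, Rec 𝔸 (M τ)) ∧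
    ∀ w ν V a e, a < e → (P w ν V (a, e) ↔
      M (profile w ν V) (encode w ν V) (fun m => (w m).2) (fun x => (w (ν x)).2) a e)

namespace Recognizable

theorem and {P P' : WordPred U S k l} (h : Recognizable 𝔸 P) (h' : Recognizable 𝔸 P') :
    Recognizable 𝔸 (fun w ν V I => P w ν V I ∧ P' w ν V I) := by
  obtain ⟨M, h1, h2⟩ := h
  obtain ⟨M', h1', h2'⟩ := h'
  exact ⟨_, fun τ => (h1 τ).and (h1' τ), fun w ν V a e hae =>
    and_congr (h2 w ν V a e hae) (h2' w ν V a e hae)⟩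

theorem or [Nonempty U] {P P' : WordPred U S k l} (h : Recognizable 𝔸 P)
    (h' : Recognizable 𝔸 P') : Recognizable 𝔸 (fun w ν V I => P w ν V I ∨ P' w ν V I) := by
  obtain ⟨M, h1, h2⟩ := h
  obtain ⟨M', h1', h2'⟩ := h'
  exact ⟨_, fun τ => (h1 τ).or (h1' τ), fun w ν V a e hae =>
    or_congr (h2 w ν V a e hae) (h2' w ν V a e hae)⟩

theorem of_profile (p : Profile S k l → Prop) :
    Recognizable 𝔸 (fun (w : ℕ → S × U) ν V _ => p (profile w ν V)) :=
  ⟨_, fun τ => Rec.const (p τ), fun _ _ _ _ _ _ => Iff.rfl⟩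

theorem not [Finite S] {𝔸 : Atoms PUnit.{1}} {P : WordPred PUnit.{1} S k l}
    (h : Recognizable 𝔸 P) : Recognizable 𝔸 (fun w ν V I => ¬ P w ν V I) := by
  obtain ⟨M, h1, h2⟩ := h
  exact ⟨_, fun τ => (h1 τ).compl, fun w ν V a e hae => not_congr (h2 w ν V a e hae)⟩

theorem seg {P : WordPred U S k l} (h : Recognizable 𝔸 P) (X : Fin l) :
    Recognizable 𝔸 (fun w ν V I => ∀ J ∈ subs I (V X), P w ν V J) := by
  obtain ⟨M, h1, h2⟩ := h
  refine ⟨_, fun τ => (h1 τ).seg (fun γ => γ.2.1 X), fun w ν V a e hae => ?_⟩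
  refine forall₂_congr fun J hJ => ?_
  exact h2 w ν V J.1 J.2 ((mem_subs_iff (I := (a, e)) hae.le).1 hJ).2.1

theorem ex [Nonempty U] [Finite S] {P : WordPred U S (k + 1) l} (h : Recognizable 𝔸 P) :
    Recognizable 𝔸 (fun w ν V I => ∃ p ∈ Set.Ico I.1 I.2, P w (Fin.cons p ν) V I) := by
  obtain ⟨M, h1, h2⟩ := h
  refine ⟨_, fun τ => Rec.exists_finite fun γ : Letter S k l =>
    (h1 (τ.addVar γ)).ex Letter.addVar γ, fun w ν V a e hae => ?_⟩
  have hd (p : ℕ) : (fun x => (w ((Fin.cons p ν : Fin (k + 1) → ℕ) x)).2) =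
      Fin.cons (w p).2 (fun x => (w (ν x)).2) := by
    funext x
    refine Fin.cases ?_ (fun x => ?_) x <;> simp
  simp only [h2 _ _ _ _ _ hae, hd, encode_cons_var, profile_cons_var]
  constructor
  · rintro ⟨p, hp, h⟩
    exact ⟨_, p, hp.1, hp.2, rfl, h⟩
  · rintro ⟨_, p, hp1, hp2, rfl, h⟩
    exact ⟨p, ⟨hp1, hp2⟩, h⟩

/-- The new profile depends on which variables belong to `X`, which the old one does not determine.
This information `t` is guessed and checked: it must agree with `X` at variables inside the scope,
and be false for variables outside it, because `X` is contained in the scope. -/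
theorem exSet [Nonempty U] [Finite S] {P : WordPred U S k (l + 1)} (h : Recognizable 𝔸 P) :
    Recognizable 𝔸 (fun w ν V I => ∃ X ⊆ Set.Ico I.1 I.2, P w ν (Fin.cons X V) I) := by
  obtain ⟨M, h1, h2⟩ := h
  let M' (τ : Profile S k l) (t : Fin k → Prop) :
      SegPred U (Letter S k (l + 1)) (Fin k) := fun g α d a e =>
    ((∀ m, a ≤ m → m < e → ∀ x, ((g m).2.2 x).2 → (t x ↔ (g m).2.1 0)) ∧
      ∀ x : {x // t x}, ¬ ∀ m, a ≤ m → m < e → ¬ ((g m).2.2 x).2) ∧ M (τ.addSet t) g α d a e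
  have hM' (τ t) : Rec 𝔸 (M' τ t) := by
    refine (Rec.and (Rec.local_all (p := fun γ d α => ∀ x, (γ.2.2 x).2 → (t x ↔ γ.2.1 0))
      fun γ => .const _) (Rec.forall_finite (ι := {x // t x}) fun x => ?_)).and (h1 _)
    -- That some position has a suitable letter is `Rec.ex` applied to the predicate that is always
    -- true.
    refine (Rec.exists_finite fun γ : {γ : Letter S k (l + 1) // (γ.2.2 x.1).2} =>
      (Rec.const (𝔸 := 𝔸) (D := Fin (k + 1)) (Γ := Letter S k (l + 1)) True).ex
        (fun γ _ _ => γ) γ.1).congr fun g α d a e hae => ?_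
    push Not
    constructor
    · rintro ⟨m, h1, h2, h3⟩
      exact ⟨⟨g m, h3⟩, m, h1, h2, rfl, trivial⟩
    · rintro ⟨γ, m, h1, h2, h3, -⟩
      exact ⟨m, h1, h2, by rw [h3]; exact γ.2⟩
  refine ⟨_, fun τ => Rec.exists_finite fun t : Fin k → Prop => (hM' τ t).exSet Letter.addSet,
    fun w ν V a e hae => ?_⟩
  simp only [h2 _ _ _ _ _ hae, encode_cons_set, profile_cons_set]
  constructor
  · rintro ⟨X, hX, h⟩
    refine ⟨fun x => ν x ∈ X, X, hX, ⟨fun m h1 h2 x h3 => ?_, fun x hx => ?_⟩, h⟩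
    · obtain rfl : m = ν x := h3
      simp [Letter.addSet]
    · exact hx (ν x) (hX x.2).1 (hX x.2).2 rfl
  · rintro ⟨t, X, hX, ⟨h3, h4⟩, h⟩
    refine ⟨X, hX, ?_⟩
    have ht : t = fun x => ν x ∈ X := by
      funext x
      refine propext ⟨fun htx => ?_, fun hx => ?_⟩
      · have := h4 ⟨x, htx⟩
        push Not at this
        obtain ⟨m, h5, h6, h7⟩ := this
        have h8 := (h3 m h5 h6 x h7).1 htx
        obtain rfl : m = ν x := h7
        simpa [Letter.addSet] using h8
      · refine (h3 (ν x) (hX hx).1 (hX hx).2 x rfl).2 ?_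
        simpa [Letter.addSet] using hx
    rw [← ht]
    exact h

end Recognizable

end Recognizable

/-! ### Formulas of Scoped MSO are recognizable -/

/-- Atoms over a one-element universe. -/
def trivialAtoms : Atoms PUnit.{1} where
  numRel := 1
  arity _ := 2
  rel _ _ := True
  exists_eq := ⟨0, rfl, fun _ _ => by simp⟩

/-- The truth values of the atomic formulas whose variables stand for the current data value
(`none`) or for one of `k` parameters. -/
abbrev AtomBits (𝔸 : Atoms U) (k : ℕ) : Type :=
  (i : Fin 𝔸.numRel) → (Fin (𝔸.arity i) → Option (Fin k)) → Prop

/-- The truth values for the data value `α` and the parameters `d`. -/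
def atomBits (𝔸 : Atoms U) {k : ℕ} (α : U) (d : Fin k → U) : AtomBits 𝔸 k :=
  fun i y => 𝔸.rel i (fun j => (y j).elim α d)

/-- The word without data whose letters record the atomic formulas with parameters `d`. -/
def annotate (𝔸 : Atoms U) {k : ℕ} (w : ℕ → σ × U) (d : Fin k → U) (m : ℕ) :
    (σ × AtomBits 𝔸 k) × PUnit.{1} :=
  (((w m).1, atomBits 𝔸 (w m).2 d), ⟨⟩)

theorem qfDef_atomBits {k : ℕ} {V : Type} (x : V) (f : Fin k → V) (b : AtomBits 𝔸 k) :
    QFDef 𝔸 (fun v : V → U => atomBits 𝔸 (v x) (fun y => v (f y)) = b) := by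
  have h : QFDef 𝔸 (fun v : V → U => ∀ i y, 𝔸.rel i (fun j => v ((y j).elim x f)) ↔ b i y) :=
    .forall_finite fun i => .forall_finite fun y => .iff (.rel i _) (.const _)
  convert h using 2 with v
  simp only [funext_iff, atomBits, eq_iff_iff]
  refine forall₂_congr fun i y => ?_
  rw [show (fun j => (y j).elim (v x) fun y => v (f y)) = fun j => v ((y j).elim x f) from
    funext fun j => by cases y j <;> rfl]

namespace Recognizable

theorem local_all {S : Type v} {k l : ℕ} {p : S → (Fin k → U) → U → Prop}
    (hp : ∀ s, QFDef 𝔸 (fun v : Fin k ⊕ Unit → U => p s (fun x => v (.inl x)) (v (.inr ())))) :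
    Recognizable 𝔸 (fun w ν (_ : Fin l → Set ℕ) I =>
      ∀ m, I.1 ≤ m → m < I.2 → p (w m).1 (fun x => (w (ν x)).2) (w m).2) :=
  ⟨_, fun _ => Rec.local_all (p := fun γ d α => p γ.1 d α) fun γ => hp γ.1,
    fun _ _ _ _ _ _ => Iff.rfl⟩

/-- Positions are annotated by reading definable bits off the data. The profile of the annotated
word also contains the bits at the variables, possibly outside the scope; they depend on the
parameters only, so they are guessed and verified locally. -/
theorem of_annotate [Nonempty U] {k l : ℕ} {P : WordPred PUnit.{1} (σ × AtomBits 𝔸 k) k l}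
    (h : Recognizable trivialAtoms P) :
    Recognizable 𝔸 (fun w ν V I => P (annotate 𝔸 w (fun x => (w (ν x)).2)) ν V I) := by
  obtain ⟨M, h1, h2⟩ := h
  let f (γ : Letter σ k l) (b : AtomBits 𝔸 k) : Letter (σ × AtomBits 𝔸 k) k l :=
    ((γ.1, b), γ.2)
  refine ⟨_, fun τ => Rec.exists_finite fun b : Fin k → AtomBits 𝔸 k => Rec.and
    (Rec.local_all (p := fun _ d _ => ∀ x, atomBits 𝔸 (d x) d = b x) fun _ => .forall_finite
      fun x => qfDef_atomBits (Sum.inl x) (fun y => Sum.inl y) (b x))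
    (Rec.of_definable_letters (atomBits 𝔸)
      (fun b => qfDef_atomBits (Sum.inr ()) (fun y => Sum.inl y) b)
      (h1 (fun x => (τ.1 x, b x), τ.2)) f), fun w ν V a e hae => ?_⟩
  beta_reduce
  rw [h2 _ _ _ _ _ hae]
  constructor
  · intro h
    exact ⟨fun x => atomBits 𝔸 (w (ν x)).2 (fun x => (w (ν x)).2), fun _ _ _ _ => rfl, h⟩
  · rintro ⟨b, hb, h⟩
    obtain rfl : (fun x => atomBits 𝔸 (w (ν x)).2 (fun x => (w (ν x)).2)) = b :=
      funext (hb a le_rfl hae)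
    exact h

end Recognizable

namespace Formula

variable [Finite σ]

/-- Formulas below a negation, where `ρ` tells which variables are not nested, and which parameters
hold their data values. -/
theorem exists_recognizable_of_wf_true {k l : ℕ} (φ : Formula σ 𝔸 k l) {k₀ : ℕ}
    (ρ : Fin k → Option (Fin k₀)) (hφ : φ.WF True (fun x => ρ x = none)) :
    ∃ P : WordPred PUnit.{1} (σ × AtomBits 𝔸 k₀) k l, Recognizable trivialAtoms P ∧
      ∀ (w : ℕ → σ × U) (d : Fin k₀ → U) ν V I, I.1 < I.2 →
        (∀ x y, ρ x = some y → d y = (w (ν x)).2) →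
        (φ.NSat w ν V I ↔ P (annotate 𝔸 w d) ν V I) := by
  induction φ with
  | ex φ ih =>
    obtain ⟨P, h1, h2⟩ := ih (Fin.cons none ρ) (by
      rw [show (fun x => (Fin.cons none ρ : Fin (_ + 1) → Option (Fin k₀)) x = none) =
        Fin.cons True (fun x => ρ x = none) from funext <| Fin.cases (by simp) (by simp)]
      exact hφ)
    refine ⟨_, h1.ex, fun w d ν V I hI hd => exists_congr fun p => and_congr_right fun hp => ?_⟩
    refine h2 w d _ V I hI fun x y => ?_
    refine Fin.cases (by simp) (fun x => ?_) x
    simpa using hd x y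
  | exSet φ ih =>
    obtain ⟨P, h1, h2⟩ := ih ρ hφ
    exact ⟨_, h1.exSet, fun w d ν V I hI hd => exists_congr fun X => and_congr_right fun _ =>
      h2 w d ν _ I hI hd⟩
  | seg X φ ih =>
    obtain ⟨P, h1, h2⟩ := ih ρ hφ
    exact ⟨_, h1.seg X, fun w d ν V I hI hd => forall₂_congr fun J hJ =>
      h2 w d ν V J ((mem_subs_iff hI.le).1 hJ).2.1 hd⟩
  | and φ ψ ih1 ih2 =>
    obtain ⟨P, h1, h2⟩ := ih1 ρ hφ.1
    obtain ⟨P', h1', h2'⟩ := ih2 ρ hφ.2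
    exact ⟨_, h1.and h1', fun w d ν V I hI hd =>
      and_congr (h2 w d ν V I hI hd) (h2' w d ν V I hI hd)⟩
  | or φ ψ ih1 ih2 =>
    obtain ⟨P, h1, h2⟩ := ih1 ρ hφ.1
    obtain ⟨P', h1', h2'⟩ := ih2 ρ hφ.2
    exact ⟨_, h1.or h1', fun w d ν V I hI hd =>
      or_congr (h2 w d ν V I hI hd) (h2' w d ν V I hI hd)⟩
  | neg φ ih =>
    obtain ⟨P, h1, h2⟩ := ih ρ hφ
    exact ⟨_, h1.not, fun w d ν V I hI hd => not_congr (h2 w d ν V I hI hd)⟩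
  | lt x y => exact ⟨_, .of_profile fun τ => τ.2.2 x y, fun w d ν V I hI hd => Iff.rfl⟩
  | mem X x => exact ⟨_, .of_profile fun τ => τ.2.1 x X, fun w d ν V I hI hd => Iff.rfl⟩
  | letter a x => exact ⟨_, .of_profile fun τ => (τ.1 x).1 = a, fun w d ν V I hI hd => Iff.rfl⟩
  | rel i x =>
    -- All nested variables of the atom coincide with `x j₀`, so its truth value is one of the bits
    -- at `x j₀`.
    by_cases hx : ∃ j, ρ (x j) = none
    · obtain ⟨j₀, hj₀⟩ := hx
      refine ⟨_, .of_profile fun τ => (τ.1 (x j₀)).2 i (fun j => ρ (x j)),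
        fun w d ν V I hI hd => ?_⟩
      change 𝔸.rel i _ ↔ 𝔸.rel i _
      refine iff_of_eq (congrArg _ (funext fun j => ?_))
      cases hj : ρ (x j) with
      | none => rw [hφ j j₀ hj hj₀]; beta_reduce; rw [hj]; rfl
      | some y => beta_reduce; rw [hj]; exact (hd _ _ hj).symm
    · push Not at hx
      -- Without nested variables the bit is the same at every position. It is read inside the
      -- scope, which is nonempty.
      refine ⟨_, .local_all (p := fun s _ _ => s.2 i (fun j => ρ (x j))) fun _ => .const _,
        fun w d ν V I hI hd => ?_⟩
      have key (α : U) : (fun j => (w (ν (x j))).2) = fun j => (ρ (x j)).elim α d := by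
        funext j
        cases hj : ρ (x j) with
        | none => exact (hx j hj).elim
        | some y => exact (hd _ _ hj).symm
      constructor
      · intro h m _ _
        change 𝔸.rel i (fun j => (ρ (x j)).elim (w m).2 d)
        rw [← key]
        exact h
      · intro h
        have := h I.1 le_rfl hI
        change 𝔸.rel i (fun j => (ρ (x j)).elim (w I.1).2 d) at this
        rwa [← key] at this

/-- Structural induction handles everything outside negations. At an outermost negation no free
variable is nested, so all of them become parameters (`ρ = some`); the negation is carried out on
the annotated word and pulled back. -/
theorem recognizable_of_wf_false [Nonempty U] {k l : ℕ} (φ : Formula σ 𝔸 k l)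
    (hφ : φ.WF False (fun _ => False)) :
    Recognizable 𝔸 (fun w ν V I => φ.NSat w ν V I) := by
  induction φ with
  | ex φ ih =>
    refine (ih ?_).ex
    rw [show (fun _ => False) = (Fin.cons False (fun _ => False) : Fin (_ + 1) → Prop) from
      funext <| Fin.cases (by simp) (by simp)]
    exact hφ
  | exSet φ ih => exact (ih hφ).exSet
  | seg X φ ih => exact (ih hφ).seg X
  | and φ ψ ih1 ih2 => exact (ih1 hφ.1).and (ih2 hφ.2)
  | or φ ψ ih1 ih2 => exact (ih1 hφ.1).or (ih2 hφ.2)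
  | neg φ ih =>
    obtain ⟨P, h1, h2⟩ := exists_recognizable_of_wf_true φ some (by simpa [WF] using hφ)
    obtain ⟨M, h3, h4⟩ := Recognizable.of_annotate h1.not
    exact ⟨M, h3, fun w ν V a e hae => (not_congr (h2 w _ ν V (a, e) hae
      (by rintro x _ ⟨⟩; rfl))).trans (h4 w ν V a e hae)⟩
  | lt x y => exact .of_profile fun τ => τ.2.2 x y
  | mem X x => exact .of_profile fun τ => τ.2.1 x X
  | letter a x => exact .of_profile fun τ => τ.1 x = a
  | rel i x =>
    obtain ⟨M, h1, h2⟩ := Recognizable.local_all (𝔸 := 𝔸) (S := σ) (l := _)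
      (p := fun _ d _ => 𝔸.rel i (fun j => d (x j))) fun _ => .rel i fun j => Sum.inl (x j)
    exact ⟨M, h1, fun w ν V a e hae => Iff.trans
      ⟨fun h _ _ _ => h, fun h => h a le_rfl hae⟩ (h2 w ν V a e hae)⟩

end Formula

/-! ### From tiling automata to register automata -/

/-- The configuration after a transition carries the tiling label of the position just read, so
local conditions concern `post` registers. An additional state `none` precedes the first label, and
it is accepting exactly if `b` holds, which settles the empty word. Tiling registers are never
`nil`, hence the conjunct `N`. -/
theorem Rec.exists_nra [Finite σ] {P : SegPred U (Letter σ 0 0) (Fin 0)} (h : Rec 𝔸 P)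
    (b : Prop) : ∃ A : NRA σ 𝔸, ([] ∈ A.language ↔ b) ∧
      ∀ (w : List (σ × U)) (hw : 0 < w.length), w ∈ A.language ↔
        P (encode (extendWord w hw) Fin.elim0 Fin.elim0) (fun m => (extendWord w hw m).2)
          Fin.elim0 0 w.length := by
  obtain ⟨M, hM⟩ := h
  have _ := M.finite_Q
  have _ := M.finite_R
  let enc (s : σ) : Letter σ 0 0 := (s, Fin.elim0, Fin.elim0)
  -- Tiling states live in `Type v`, those of an `NRA` in `Type`.
  let Q := Fin (Nat.card M.Q)
  let f : Q ≃ M.Q := (Finite.equivFin M.Q).symm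
  let V := ConstrVar M.R
  let ι : M.R ⊕ (Fin 0 ⊕ Unit) → V :=
    Sum.elim ConstrVar.post (Sum.elim Fin.elim0 fun _ => ConstrVar.input)
  choose Φ hΦ using M.loc_def
  have hnil : ∃ N : QFFormula 𝔸 V, ∀ ν, N.Holds ν ↔ ∀ r, ν (.post r) ≠ none :=
    QFFormula.exists_forall fun r => .neg (.isNil (ConstrVar.post r))
  obtain ⟨N, hN⟩ := hnil
  have hkeep (K : Set M.R) : ∃ N : QFFormula 𝔸 V, ∀ ν, N.Holds ν ↔
      ∀ r : K, ∃ a, ν (.pre r) = some a ∧ ν (.post r) = some a := by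
    obtain ⟨N, hN⟩ := QFFormula.exists_forall fun r : K => QFFormula.eq 𝔸 (V := V)
      (.pre r.1) (.post r)
    exact ⟨N, fun ν => by simp only [hN, QFFormula.holds_eq]⟩
  choose K hK using hkeep
  let A : NRA σ 𝔸 :=
    { Q := Option Q
      finite_Q := inferInstance
      R := M.R
      finite_R := M.finite_R
      initial := {none}
      accepting := {x | x = none ∧ b ∨ ∃ q, x = some q ∧ f q ∈ M.last}
      rules := Set.range (fun t : σ × {q : Q // f q ∈ M.first} =>
          (none, t.1, .and N ((Φ (f t.2) (enc t.1)).map ι), some t.2.1)) ∪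
        Set.range (fun t : σ × {q : Q × Q // M.next (f q.1) (f q.2)} =>
          (some t.2.1.1, t.1, .and (.and N (K (M.keep (f t.2.1.1) (f t.2.1.2))))
            ((Φ (f t.2.1.2) (enc t.1)).map ι), some t.2.1.2))
      finite_rules := (Set.finite_range _).union (Set.finite_range _) }
  have hstep (c : A.Conf) (s : σ × U) (c' : A.Conf) : A.Step c s c' ↔
      ∃ (q' : Q) (μ : M.R → U), c'.1 = some q' ∧ (∀ r, c'.2 r = some (μ r)) ∧
        M.loc (f q') (enc s.1) μ Fin.elim0 s.2 ∧
        (c.1 = none ∧ f q' ∈ M.first ∨ ∃ q, c.1 = some q ∧ M.next (f q) (f q') ∧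
          ∀ r ∈ M.keep (f q) (f q'), c.2 r = some (μ r)) := by
    have hpost : N.Holds (constrVal c.2 s.2 c'.2) ↔ ∃ μ : M.R → U, ∀ r, c'.2 r = some (μ r) := by
      rw [hN]
      constructor
      · intro h
        choose μ hμ using fun r => Option.ne_none_iff_exists'.1 (h r)
        exact ⟨μ, hμ⟩
      · rintro ⟨μ, hμ⟩ r
        simp [constrVal, hμ]
    have hval (μ : M.R → U) (hμ : ∀ r, c'.2 r = some (μ r)) (q : M.Q) (γ) :
        ((Φ q γ).map ι).Holds (constrVal c.2 s.2 c'.2) ↔ M.loc q γ μ Fin.elim0 s.2 := by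
      rw [QFFormula.holds_map, show constrVal c.2 s.2 c'.2 ∘ ι =
        fun x => some (Sum.elim μ (Sum.elim Fin.elim0 fun _ => s.2) x) from ?_]
      · exact hΦ q γ _
      · funext x
        rcases x with r | x | x
        · exact hμ r
        · exact x.elim0
        · rfl
    have hK' (μ : M.R → U) (hμ : ∀ r, c'.2 r = some (μ r)) (S : Set M.R) :
        (K S).Holds (constrVal c.2 s.2 c'.2) ↔ ∀ r ∈ S, c.2 r = some (μ r) := by
      rw [hK]
      simp [constrVal, hμ]
    constructor
    · rintro ⟨Ψ, h1, h2⟩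
      rcases h1 with ⟨⟨t, q, hq⟩, ht⟩ | ⟨⟨t, q, hq⟩, ht⟩
      · obtain ⟨h3, rfl, rfl, h4⟩ : none = c.1 ∧ t = s.1 ∧ _ = Ψ ∧ some q = c'.1 := by
          simpa only [Prod.mk.injEq] using ht
        obtain ⟨μ, hμ⟩ := hpost.1 h2.1
        exact ⟨q, μ, h4.symm, hμ, (hval μ hμ _ _).1 h2.2, .inl ⟨h3.symm, hq⟩⟩
      · obtain ⟨h3, rfl, rfl, h4⟩ : some q.1 = c.1 ∧ t = s.1 ∧ _ = Ψ ∧ some q.2 = c'.1 := by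
          simpa only [Prod.mk.injEq] using ht
        obtain ⟨μ, hμ⟩ := hpost.1 h2.1.1
        exact ⟨q.2, μ, h4.symm, hμ, (hval μ hμ _ _).1 h2.2,
          .inr ⟨q.1, h3.symm, hq, (hK' μ hμ _).1 h2.1.2⟩⟩
    · rintro ⟨q', μ, h1, hμ, h2, ⟨h3, h4⟩ | ⟨q, h3, h4, h5⟩⟩
      · refine ⟨.and N ((Φ (f q') (enc s.1)).map ι), .inl ⟨(s.1, ⟨q', h4⟩), ?_⟩, hpost.2 ⟨μ, hμ⟩,
          (hval μ hμ _ _).2 h2⟩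
        rw [h1, h3]
      · refine ⟨.and (.and N (K (M.keep (f q) (f q')))) ((Φ (f q') (enc s.1)).map ι),
          .inr ⟨(s.1, ⟨(q, q'), h4⟩), ?_⟩, ⟨hpost.2 ⟨μ, hμ⟩, (hK' μ hμ _).2 h5⟩,
          (hval μ hμ _ _).2 h2⟩
        rw [h1, h3]
  have henc (w : ℕ → σ × U) (m : ℕ) : encode w Fin.elim0 Fin.elim0 m = enc (w m).1 :=
    Prod.ext rfl (Subsingleton.elim _ _)
  refine ⟨A, ?_, fun w hw => ?_⟩
  · constructor
    · rintro ⟨c, hc⟩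
      have h0 : (c 0).1 = none := hc.initial_state
      rcases hc.accepting_state with h | ⟨q, h, -⟩
      · exact h.2
      · exact absurd (h0.symm.trans h) (by simp)
    · intro hb
      exact ⟨fun _ => (none, fun _ => none), rfl, fun _ => rfl, fun i => i.elim0, .inl ⟨rfl, hb⟩⟩
  rw [hM _ _ _ _ _ hw]
  constructor
  · rintro ⟨c, hc⟩
    have h1 (m : ℕ) : ∃ (q : Q) (μ : M.R → U), ∀ hm : m < w.length,
        (c (⟨m, hm⟩ : Fin _).succ).1 = some q ∧ (∀ r, (c (⟨m, hm⟩ : Fin _).succ).2 r = some (μ r)) ∧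
        M.loc (f q) (enc (w.get ⟨m, hm⟩).1) μ Fin.elim0 (w.get ⟨m, hm⟩).2 ∧
        ((c (⟨m, hm⟩ : Fin _).castSucc).1 = none ∧ f q ∈ M.first ∨
          ∃ q', (c (⟨m, hm⟩ : Fin _).castSucc).1 = some q' ∧ M.next (f q') (f q) ∧
          ∀ r ∈ M.keep (f q') (f q), (c (⟨m, hm⟩ : Fin _).castSucc).2 r = some (μ r)) := by
      by_cases hm : m < w.length
      · obtain ⟨q, μ, h⟩ := (hstep _ _ _).1 (hc.step ⟨m, hm⟩)
        exact ⟨q, μ, fun _ => h⟩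
      · exact ⟨f.symm (Classical.choice M.nonempty_Q), fun _ => (w.get ⟨0, hw⟩).2,
          fun h => (hm h).elim⟩
    choose q μ h1 using h1
    refine ⟨fun m => f (q m), μ, ?_, ?_, ?_, ?_, ?_⟩
    · obtain ⟨-, -, -, h2 | ⟨q', h2, -⟩⟩ := h1 0 hw
      · exact h2.2
      · exact absurd (hc.initial_state.symm.trans h2) (by simp)
    · have h2 := (h1 (w.length - 1) (by omega)).1
      have h3 := hc.accepting_state
      rw [show Fin.last w.length = (⟨w.length - 1, by omega⟩ : Fin w.length).succ from
        Fin.ext (by simp; omega), h2] at h3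
      rcases h3 with h3 | ⟨q', h3, h4⟩
      · exact absurd h3.1 (by simp)
      · exact Option.some.inj h3 ▸ h4
    · intro m _ hm
      have h2 := (h1 m (by omega)).1
      obtain ⟨-, -, -, h3 | ⟨q', h3, h4, h5⟩⟩ := h1 (m + 1) hm
      · exact absurd (h2.symm.trans h3.1) (by simp)
      · exact Option.some.inj (h2.symm.trans h3) ▸ h4
    · intro m _ hm r hr
      have h2 := h1 m (by omega)
      obtain ⟨-, -, -, h3 | ⟨q', h3, h4, h5⟩⟩ := h1 (m + 1) hm
      · exact absurd (h2.1.symm.trans h3.1) (by simp)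
      · obtain rfl := Option.some.inj (h2.1.symm.trans h3)
        exact Option.some.inj ((h2.2.1 r).symm.trans (h5 r hr))
    · intro m _ hm
      have h2 := (h1 m hm).2.2.1
      rwa [← extendWord_fin w hw, ← henc] at h2
  · rintro ⟨q, μ, hr⟩
    refine ⟨Fin.cons (none, fun _ => none) fun i => (some (f.symm (q i)), fun r => some (μ i r)),
      rfl, fun _ => rfl, fun i => (hstep _ _ _).2 ⟨f.symm (q i), μ i, rfl,
        fun _ => rfl, ?_, ?_⟩, ?_⟩
    · rw [← extendWord_fin w hw, ← henc, f.apply_symm_apply]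
      exact hr.loc i (Nat.zero_le _) i.2
    · obtain ⟨m, hm⟩ := i
      rcases m with _ | m
      · exact .inl ⟨rfl, by simpa using hr.first⟩
      · refine .inr ⟨f.symm (q m), rfl, ?_, fun r hkeep => ?_⟩
        · simpa using hr.next m (Nat.zero_le _) hm
        · exact congrArg some (hr.keep m (Nat.zero_le _) hm r (by simpa using hkeep))
    · refine .inr ⟨f.symm (q (w.length - 1)), ?_, by simpa using hr.last⟩
      rw [show Fin.last w.length = (⟨w.length - 1, by omega⟩ : Fin w.length).succ from
        Fin.ext (by simp; omega), Fin.cons_succ]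

/-- Every sentence of Scoped MSO has an equivalent register automaton. -/
theorem Formula.exists_nra_language_eq [Finite σ] [Nonempty U] (φ : Formula σ 𝔸 0 0)
    (hφ : φ.WellFormed) : ∃ A : NRA σ 𝔸, A.language = φ.language := by
  have hφ' : φ.WF False (fun _ => False) := by
    rw [show (fun _ => False : Fin 0 → Prop) = Fin.elim0 from Subsingleton.elim _ _]
    exact hφ
  obtain ⟨M, h1, h2⟩ := φ.recognizable_of_wf_false hφ'
  obtain ⟨A, h3, h4⟩ := (h1 (Fin.elim0, Fin.elim0, Fin.elim0)).exists_nra ([] ∈ φ.language)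
  refine ⟨A, Set.ext fun w => ?_⟩
  rcases w.length.eq_zero_or_pos with h | h
  · rw [List.length_eq_zero_iff.1 h]
    exact h3
  · refine (h4 w h).trans (Iff.trans ?_ (φ.mem_language_iff w h).symm)
    refine Iff.trans (iff_of_eq ?_) (h2 _ _ _ _ _ h).symm
    congr 1 <;> exact Subsingleton.elim _ _

/-! ### Families of intervals of bounded depth -/

/-- A family of tokens, each of which is a position `p` that is active at every position of an
interval around `p`; `T m` is the set of tokens that are active at `m`. -/
structure TokenFamily (T : ℕ → Set ℕ) : Prop where
  finite : ∀ m, (T m).Finite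
  star : ∀ p m m', p ∈ T m → (p ≤ m' ∧ m' ≤ m ∨ m ≤ m' ∧ m' ≤ p) → p ∈ T m'
  bounded : ∃ n, ∀ m, n ≤ m → T m = ∅

namespace TokenFamily

variable {T : ℕ → Set ℕ}

theorem self_mem (hT : TokenFamily T) {p m : ℕ} (h : p ∈ T m) : p ∈ T p :=
  hT.star p m p h (by omega)

theorem ordConnected (hT : TokenFamily T) {p a b c : ℕ} (ha : p ∈ T a) (hb : p ∈ T b)
    (h1 : a ≤ c) (h2 : c ≤ b) :
    p ∈ T c := by
  rcases le_total p c with h | h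
  · exact hT.star p b c hb (.inl ⟨h, h2⟩)
  · exact hT.star p a c ha (.inr ⟨h1, h⟩)

theorem exists_furthest (hT : TokenFamily T) (m : ℕ) :
    ∃ c : Option ℕ, (c = none → T m = ∅) ∧ ∀ p, c = some p →
    p ∈ T m ∧ ∀ q ∈ T m, ∀ m', m ≤ m' → q ∈ T m' → p ∈ T m' := by
  obtain ⟨n, hn⟩ := hT.bounded
  rcases (T m).eq_empty_or_nonempty with h | h
  · exact ⟨none, fun _ => h, by simp⟩
  obtain ⟨p, hp, hmax⟩ := Set.exists_max_image (T m) (fun q => sSup {m' | q ∈ T m'})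
    (hT.finite m) h
  refine ⟨some p, by simp, ?_⟩
  rintro _ ⟨⟩
  have hb (q : ℕ) : BddAbove {m' | q ∈ T m'} := ⟨n, fun m' hm' => by
    by_contra h
    have : q ∈ T m' := hm'
    rw [hn m' (by omega)] at this
    exact this⟩
  refine ⟨hp, fun q hq m' hm' hqm' => ?_⟩
  have h1 : p ∈ T (sSup {m' | p ∈ T m'}) := Nat.sSup_mem (s := {m' | p ∈ T m'}) ⟨m, hp⟩ (hb p)
  exact hT.ordConnected hp h1 hm' ((le_csSup (hb q) hqm').trans (hmax q hq))

/-- A partition into blocks, numbered by `J`, such that every token is active in at most two blocks,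
and such that every nonempty block has a token `cur` that is active in the whole block. -/
theorem exists_blocks (hT : TokenFamily T) : ∃ (J : ℕ → ℕ) (cur : ℕ → Option ℕ),
    (∀ m, J (m + 1) = J m ∨ J (m + 1) = J m + 1) ∧
    (∀ m p, cur m = some p → p ∈ T m) ∧
    (∀ m, cur m = none → T m = ∅) ∧
    (∀ m m' q, m ≤ m' → q ∈ T m → q ∈ T m' → J m' ≤ J m + 1) ∧
    (∀ m m', m ≤ m' → J m = J m' → cur m = cur m') ∧
    (∀ m m' p, m ≤ m' → cur m = some p → p ∈ T m' → J m' = J m ∧ cur m' = some p) := by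
  classical
  choose best hbest1 hbest2 using hT.exists_furthest
  -- Greedy choice: a token is kept while it is active, and then replaced by one that reaches
  -- furthest to the right.
  let cur (m : ℕ) : Option ℕ := Nat.rec (best 0)
    (fun m c => if ∃ p, c = some p ∧ p ∈ T (m + 1) then c else best (m + 1)) m
  let keep (m : ℕ) : Prop := ∃ p, cur m = some p ∧ p ∈ T (m + 1)
  let J (m : ℕ) : ℕ := Nat.rec 0 (fun m j => if keep m then j else j + 1) m
  have cur_keep {m} (h : keep m) : cur (m + 1) = cur m := if_pos h
  have cur_new {m} (h : ¬ keep m) : cur (m + 1) = best (m + 1) := if_neg h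
  have J_keep {m} (h : keep m) : J (m + 1) = J m := if_pos h
  have J_new {m} (h : ¬ keep m) : J (m + 1) = J m + 1 := if_neg h
  have hJ (m) : J (m + 1) = J m ∨ J (m + 1) = J m + 1 := by
    by_cases h : keep m
    · exact .inl (J_keep h)
    · exact .inr (J_new h)
  have hmono : Monotone J := monotone_nat_of_le_succ fun m => by rcases hJ m with h | h <;> omega
  refine ⟨J, cur, hJ, ?_, ?_, ?_, ?_, ?_⟩
  · intro m p hp
    induction m with
    | zero => exact (hbest2 0 p hp).1
    | succ m ih =>
      by_cases h : keep m
      · obtain ⟨q, h1, h2⟩ := id h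
        rw [cur_keep h, h1] at hp
        exact Option.some.inj hp ▸ h2
      · rw [cur_new h] at hp
        exact (hbest2 _ p hp).1
  · intro m hm
    induction m with
    | zero => exact hbest1 0 hm
    | succ m ih =>
      by_cases h : keep m
      · obtain ⟨q, h1, h2⟩ := id h
        rw [cur_keep h, h1] at hm
        simp at hm
      · rw [cur_new h] at hm
        exact hbest1 _ hm
  · intro m m' q hm hq hq'
    -- If `q` is still active when the second block starts, the token chosen there reaches at least
    -- as far as `q`, so `q` never meets a third block.
    suffices h : J m' = J m ∨ J m' = J m + 1 ∧ ∃ p, cur m' = some p ∧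
        ∀ x, m' ≤ x → q ∈ T x → p ∈ T x by
      rcases h with h | h
      · omega
      · omega
    induction m', hm using Nat.le_induction with
    | base => exact .inl rfl
    | succ m' hm ih =>
      by_cases hk : keep m'
      · rw [J_keep hk, cur_keep hk]
        rcases ih (hT.ordConnected hq hq' hm (by omega)) with h | ⟨h, p, h1, h2⟩
        · exact .inl h
        · exact .inr ⟨h, p, h1, fun x hx => h2 x (by omega)⟩
      · rw [J_new hk, cur_new hk]
        rcases ih (hT.ordConnected hq hq' hm (by omega)) with h | ⟨h, p, h1, h2⟩
        · refine .inr ⟨by omega, ?_⟩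
          cases hb : best (m' + 1) with
          | none => rw [hbest1 _ hb] at hq'; exact hq'.elim
          | some p => exact ⟨p, rfl, fun x hx hqx => (hbest2 _ p hb).2 q hq' x hx hqx⟩
        · exact (hk ⟨p, h1, h2 _ (by omega) hq'⟩).elim
  · intro m m' hm h
    induction m', hm using Nat.le_induction with
    | base => rfl
    | succ m' hm ih =>
      have h1 := hmono hm
      by_cases hk : keep m'
      · rw [cur_keep hk]
        exact ih (by rw [h, J_keep hk])
      · have := J_new hk
        omega
  · intro m m' p hm hp hp'
    induction m', hm using Nat.le_induction with
    | base => exact ⟨rfl, hp⟩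
    | succ m' hm ih =>
      have hpm : p ∈ T m' := by
        refine hT.ordConnected (a := m) ?_ hp' hm (by omega)
        clear ih hp' hm
        induction m with
        | zero => exact (hbest2 0 p hp).1
        | succ m ih =>
          by_cases h : keep m
          · obtain ⟨q, h1, h2⟩ := id h
            rw [cur_keep h, h1] at hp
            exact Option.some.inj hp ▸ h2
          · rw [cur_new h] at hp
            exact (hbest2 _ p hp).1
      obtain ⟨h1, h2⟩ := ih hpm
      have hk : keep m' := ⟨p, h2, hp'⟩
      exact ⟨(J_keep hk).trans h1, (cur_keep hk).trans h2⟩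

/-- Induction on the depth `k`. Every position with an active token has an active current token of
`exists_blocks`, so removing the current tokens lowers the depth by one. The removed tokens form
three new levels above the others, according to the number of their block modulo 3, and these levels
use the new blocks; every token, of whatever level, meets at most two of them. The last property
makes a token the nearest one of its level as seen from any position where it is active. -/
theorem exists_levels (k : ℕ) {T : ℕ → Set ℕ} (hT : TokenFamily T) (hk : ∀ m, (T m).ncard ≤ k) :
    ∃ (J : ℕ → ℕ → ℕ) (lev : ℕ → ℕ),
      (∀ i m, J i (m + 1) = J i m ∨ J i (m + 1) = J i m + 1) ∧
      (∀ p m, p ∈ T m → lev p < 3 * k) ∧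
      (∀ p m i, p ∈ T m → lev p ≤ i → J i m ≤ J i p + 1 ∧ J i p ≤ J i m + 1) ∧
      (∀ p p' m m', p ∈ T m → p' ∈ T m' → lev p = lev p' → J (lev p) m = J (lev p) m' → p = p') ∧
      (∀ p p' m, p ∈ T m → p' ∈ T p' → lev p = lev p' →
        (p ≤ p' ∧ p' ≤ m ∨ m ≤ p' ∧ p' ≤ p) → p' = p) := by
  classical
  induction k generalizing T with
  | zero =>
    have h0 (m p) (hp : p ∈ T m) : False := by
      have := (Set.ncard_eq_zero (hT.finite m)).1 (Nat.le_zero.1 (hk m))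
      rw [this] at hp
      exact hp
    exact ⟨fun _ _ => 0, fun _ => 0, fun _ _ => .inl rfl, fun p m h => (h0 m p h).elim,
      fun p m _ h => (h0 m p h).elim, fun p _ m _ h => (h0 m p h).elim,
      fun p _ m h => (h0 m p h).elim⟩
  | succ k ih =>
    obtain ⟨J, cur, hJ, hcur, hnone, hspan, hcurJ, hkeep⟩ := hT.exists_blocks
    have hmono : Monotone J := monotone_nat_of_le_succ fun m => by
      rcases hJ m with h | h <;> omega
    let C : Set ℕ := {p | ∃ m, cur m = some p}
    have hT' : TokenFamily (fun m => T m \ C) := by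
      refine ⟨fun m => (hT.finite m).sdiff, fun p m m' hp hm => ⟨hT.star p m m' hp.1 hm, hp.2⟩, ?_⟩
      obtain ⟨n, hn⟩ := hT.bounded
      exact ⟨n, fun m hm => by simp [hn m hm]⟩
    obtain ⟨J', lev', h1, h2, h3, h4, h5⟩ := ih hT' (fun m => by
      have := hk m
      cases hc : cur m with
      | none => simp [hnone m hc]
      | some p =>
        have h1 : (T m \ C).ncard < (T m).ncard := Set.ncard_lt_ncard
          ⟨Set.sdiff_subset, fun h => (h (hcur m p hc)).2 ⟨m, hc⟩⟩ (hT.finite m)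
        omega)
    -- `idx p` is the number of the only block in which `p` is current.
    have hidx (p : ℕ) : ∃ j, ∀ m, cur m = some p → J m = j := by
      by_cases hp : p ∈ C
      · obtain ⟨m, hm⟩ := hp
        refine ⟨J m, fun m' hm' => ?_⟩
        rcases le_total m m' with h | h
        · exact (hkeep m m' p h hm (hcur m' p hm')).1
        · exact (hkeep m' m p h hm' (hcur m p hm)).1.symm
      · exact ⟨0, fun m hm => (hp ⟨m, hm⟩).elim⟩
    choose idx hidx using hidx
    have idx_inj {p p'} (hp : p ∈ C) (hp' : p' ∈ C) (h : idx p = idx p') : p = p' := by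
      obtain ⟨m, hm⟩ := hp
      obtain ⟨m', hm'⟩ := hp'
      have h1 := hidx p m hm
      have h2 := hidx p' m' hm'
      have h3 : cur m = cur m' := by
        rcases le_total m m' with h' | h'
        · exact hcurJ m m' h' (by omega)
        · exact (hcurJ m' m h' (by omega)).symm
      rw [hm, hm'] at h3
      exact Option.some.inj h3
    -- A current token can start in the preceding block, but it ends with its own block: otherwise
    -- it would have been kept.
    have idx_block {p x} (hp : p ∈ C) (hx : p ∈ T x) : J x ≤ idx p ∧ idx p ≤ J x + 1 := by
      obtain ⟨m, hm⟩ := hp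
      rw [← hidx p m hm]
      rcases le_total m x with h | h
      · have := (hkeep m x p h hm hx).1
        omega
      · exact ⟨hmono h, hspan x m p h hx (hcur m p hm)⟩
    -- Tokens met at one position have block numbers differing by at most 1. For the last property
    -- the numbers of `p'` and `p` can differ by 1 in either direction, still distinct modulo 3
    -- unless equal; residues modulo 2 would confuse `idx p - 1` and `idx p + 1`.
    refine ⟨fun i => if i < 3 * k then J' i else J,
      fun p => if p ∈ C then 3 * k + idx p % 3 else lev' p, ?_, ?_, ?_, ?_, ?_⟩
    · intro i m
      dsimp only
      split_ifs
      · exact h1 i m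
      · exact hJ m
    · intro p m hp
      dsimp only
      split_ifs with hC
      · omega
      · have := h2 p m ⟨hp, hC⟩
        omega
    · intro p m i hp hi
      dsimp only at hi ⊢
      have hpp := hT.self_mem hp
      by_cases hik : i < 3 * k
      · have hC : p ∉ C := fun hC => by
          rw [if_pos hC] at hi
          omega
        rw [if_neg hC] at hi
        simpa [hik] using h3 p m i ⟨hp, hC⟩ hi
      · simp only [hik, if_false]
        rcases le_total p m with h | h
        · exact ⟨hspan p m p h hpp hp, (hmono h).trans (by omega)⟩
        · exact ⟨(hmono h).trans (by omega), hspan m p p h hp hpp⟩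
    · intro p p' m m' hp hp' hlev hJJ
      dsimp only at hlev hJJ
      by_cases hC : p ∈ C <;> by_cases hC' : p' ∈ C
      · simp only [hC, hC', if_true, Nat.add_right_inj, Nat.not_lt.2 (Nat.le_add_right _ _),
          if_false] at hlev hJJ
        have k1 := idx_block hC hp
        have k2 := idx_block hC' hp'
        exact idx_inj hC hC' (by omega)
      · have := h2 p' m' ⟨hp', hC'⟩
        rw [if_pos hC, if_neg hC'] at hlev
        omega
      · have := h2 p m ⟨hp, hC⟩
        rw [if_neg hC, if_pos hC'] at hlev
        omega
      · have := h2 p m ⟨hp, hC⟩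
        simp only [hC, hC', if_false, this, if_true] at hlev hJJ
        exact h4 p p' m m' ⟨hp, hC⟩ ⟨hp', hC'⟩ hlev hJJ
    · intro p p' m hp hp' hlev hb
      dsimp only at hlev
      by_cases hC : p ∈ C <;> by_cases hC' : p' ∈ C
      · simp only [hC, hC', if_true, Nat.add_right_inj] at hlev
        have k1 := idx_block hC hp
        have k2 := idx_block hC (hT.self_mem hp)
        have k3 := idx_block hC' hp'
        refine idx_inj hC' hC ?_
        rcases hb with ⟨hb1, hb2⟩ | ⟨hb1, hb2⟩
        · have := hmono hb1
          have := hmono hb2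
          omega
        · have := hmono hb1
          have := hmono hb2
          omega
      · have := h2 p' p' ⟨hp', hC'⟩
        rw [if_pos hC, if_neg hC'] at hlev
        omega
      · have := h2 p m ⟨hp, hC⟩
        rw [if_neg hC, if_pos hC'] at hlev
        omega
      · rw [if_neg hC, if_neg hC'] at hlev
        exact h5 p p' m ⟨hp, hC⟩ ⟨hp', hC'⟩ hlev hb

end TokenFamily

/-! ### Predicates that are definable in Scoped MSO -/

/-- Definability by a formula that satisfies the well-formedness condition. -/
def Definable (𝔸 : Atoms U) {k l : ℕ} (b : Prop) (nested : Fin k → Prop) (P : WordPred U σ k l) :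
    Prop :=
  ∃ φ : Formula σ 𝔸 k l, φ.WF b nested ∧ ∀ w ν V I, φ.NSat w ν V I ↔ P w ν V I

namespace Definable

variable {k l : ℕ} {b : Prop} {nested : Fin k → Prop} {P P' : WordPred U σ k l}

theorem congr (h : Definable 𝔸 b nested P) (hP : ∀ w ν V I, P' w ν V I ↔ P w ν V I) :
    Definable 𝔸 b nested P' := by
  obtain ⟨φ, h1, h2⟩ := h
  exact ⟨φ, h1, fun w ν V I => (h2 w ν V I).trans (hP w ν V I).symm⟩

theorem and (h : Definable 𝔸 b nested P) (h' : Definable 𝔸 b nested P') :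
    Definable 𝔸 b nested (fun w ν V I => P w ν V I ∧ P' w ν V I) := by
  obtain ⟨φ, h1, h2⟩ := h
  obtain ⟨φ', h1', h2'⟩ := h'
  exact ⟨.and φ φ', ⟨h1, h1'⟩, fun w ν V I => and_congr (h2 w ν V I) (h2' w ν V I)⟩

theorem not (h : Definable 𝔸 True nested P) :
    Definable 𝔸 b nested (fun w ν V I => ¬ P w ν V I) := by
  obtain ⟨φ, h1, h2⟩ := h
  exact ⟨.neg φ, h1, fun w ν V I => not_congr (h2 w ν V I)⟩

theorem imp (h : Definable 𝔸 True nested P) (h' : Definable 𝔸 True nested P') :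
    Definable 𝔸 b nested (fun w ν V I => P w ν V I → P' w ν V I) :=
  (h.and h'.not).not.congr fun _ _ _ _ => by simp

theorem const (p : Prop) :
    Definable 𝔸 b nested (fun (_ : ℕ → σ × U) _ (_ : Fin l → Set ℕ) _ => p) := by
  by_cases hp : p
  -- There are no constants among the formulas; `∃ x, x < x` is false in every scope, even the empty
  -- one.
  · exact ⟨.neg (.ex (.lt 0 0)), trivial, fun w ν V I => by simp [Formula.NSat, hp]⟩
  · exact ⟨.neg (.neg (.ex (.lt 0 0))), trivial, fun w ν V I => by simp [Formula.NSat, hp]⟩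

theorem iff (h : Definable 𝔸 True nested P) (h' : Definable 𝔸 True nested P') :
    Definable 𝔸 b nested (fun w ν V I => P w ν V I ↔ P' w ν V I) :=
  ((h.imp h').and (h'.imp h)).congr fun _ _ _ _ => iff_def

theorem forall_finite {ι : Type*} [Finite ι] {P : ι → WordPred U σ k l}
    (h : ∀ i, Definable 𝔸 b nested (P i)) :
    Definable 𝔸 b nested (fun w ν V I => ∀ i, P i w ν V I) := by
  obtain ⟨s, hs⟩ := Finite.exists_univ_list ι
  suffices h : ∀ s : List ι, Definable 𝔸 b nested (fun w ν V I => ∀ i ∈ s, P i w ν V I) from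
    (h s).congr fun w ν V I => by simp [hs.2]
  intro s
  induction s with
  | nil => exact (const True).congr fun w ν V I => by simp
  | cons i s ih => exact ((h i).and ih).congr fun w ν V I => by simp

theorem ex {P : WordPred U σ (k + 1) l}
    (h : Definable 𝔸 b (Fin.cons b nested : Fin (k + 1) → Prop) P) :
    Definable 𝔸 b nested (fun w ν V I => ∃ p ∈ Set.Ico I.1 I.2, P w (Fin.cons p ν) V I) := by
  obtain ⟨φ, h1, h2⟩ := h
  exact ⟨.ex φ, h1, fun w ν V I => exists_congr fun p => and_congr_right fun _ => h2 w _ V I⟩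

theorem all {P : WordPred U σ (k + 1) l}
    (h : Definable 𝔸 True (Fin.cons True nested : Fin (k + 1) → Prop) P) :
    Definable 𝔸 b nested (fun w ν V I => ∀ p ∈ Set.Ico I.1 I.2, P w (Fin.cons p ν) V I) :=
  (ex h.not).not.congr fun w ν V I => by simp

theorem exSets {P : WordPred U σ k l} (h : Definable 𝔸 b nested P) :
    Definable 𝔸 b nested (fun w ν (_ : Fin 0 → Set ℕ) I =>
      ∃ V : Fin l → Set ℕ, (∀ X, V X ⊆ Set.Ico I.1 I.2) ∧ P w ν V I) := by
  induction l with
  | zero =>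
    refine h.congr fun w ν V I => ⟨fun ⟨V', _, h⟩ => ?_, fun h => ⟨V, fun X => X.elim0, h⟩⟩
    rwa [Subsingleton.elim V V']
  | succ l ih =>
    obtain ⟨φ, h1, h2⟩ := h
    have h3 : Definable 𝔸 b nested (fun w ν V I => ∃ X ⊆ Set.Ico I.1 I.2, P w ν (Fin.cons X V) I) :=
      ⟨.exSet φ, h1, fun w ν V I => exists_congr fun X => and_congr_right fun _ => h2 w ν _ I⟩
    refine (ih h3).congr fun w ν V I => ?_
    constructor
    · rintro ⟨V', h4, h5⟩
      exact ⟨fun X => V' X.succ, fun X => h4 _, V' 0, h4 0, by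
        rwa [show Fin.cons (V' 0) (fun X => V' X.succ) = V' from Fin.cons_self_tail V']⟩
    · rintro ⟨V', h4, X, h5, h6⟩
      exact ⟨Fin.cons X V', Fin.cases h5 h4, h6⟩

theorem segEx {P : WordPred U σ (k + 1) l}
    (h : Definable 𝔸 b (Fin.cons b nested : Fin (k + 1) → Prop) P) (X : Fin l) :
    Definable 𝔸 b nested (fun w ν V I => ∀ J ∈ subs I (V X),
      ∃ p ∈ Set.Ico J.1 J.2, P w (Fin.cons p ν) V J) := by
  obtain ⟨φ, h1, h2⟩ := h.ex
  exact ⟨.seg X φ, h1, fun w ν V I => forall₂_congr fun J _ => h2 w ν V J⟩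

theorem lt (x y : Fin k) : Definable 𝔸 b nested
    (fun (_ : ℕ → σ × U) ν (_ : Fin l → Set ℕ) _ => ν x < ν y) :=
  ⟨.lt x y, trivial, fun _ _ _ _ => Iff.rfl⟩

theorem mem (X : Fin l) (x : Fin k) : Definable 𝔸 b nested
    (fun (_ : ℕ → σ × U) ν (V : Fin l → Set ℕ) _ => ν x ∈ V X) :=
  ⟨.mem X x, trivial, fun _ _ _ _ => Iff.rfl⟩

theorem letter (a : σ) (x : Fin k) : Definable 𝔸 b nested
    (fun (w : ℕ → σ × U) ν (_ : Fin l → Set ℕ) _ => (w (ν x)).1 = a) :=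
  ⟨.letter a x, trivial, fun _ _ _ _ => Iff.rfl⟩

theorem rel (i : Fin 𝔸.numRel) (x : Fin (𝔸.arity i) → Fin k)
    (hx : ∀ y z, nested y → nested z → y = z) : Definable 𝔸 b nested
    (fun (w : ℕ → σ × U) ν (_ : Fin l → Set ℕ) _ => 𝔸.rel i (fun j => (w (ν (x j))).2)) :=
  ⟨.rel i x, fun _ _ => hx _ _, fun _ _ _ _ => Iff.rfl⟩

/-- Truth of a quantifier-free formula in which every variable stands for `nil` or for the data value
at a position. -/
theorem holds {W : Type} (Φ : QFFormula 𝔸 W) (f : W → Option (Fin k))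
    (hx : ∀ y z, nested y → nested z → y = z) : Definable 𝔸 True nested
    (fun (w : ℕ → σ × U) ν (_ : Fin l → Set ℕ) _ =>
      Φ.Holds (fun y => (f y).map fun x => (w (ν x)).2)) := by
  induction Φ with
  | top => exact const True
  | neg Φ ih => exact ih.not
  | and Φ Ψ ih1 ih2 => exact ih1.and ih2
  | isNil y =>
    refine (const (f y = none)).congr fun w ν V I => ?_
    simp [QFFormula.Holds]
  | rel i y =>
    by_cases h : ∃ x : Fin (𝔸.arity i) → Fin k, ∀ j, f (y j) = some (x j)
    · obtain ⟨x, hxy⟩ := h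
      refine (rel i x hx).congr fun w ν V I => ?_
      simp only [QFFormula.Holds, hxy, Option.map_some, Option.some.injEq]
      constructor
      · rintro ⟨a, ha, h⟩
        rwa [show (fun j => (w (ν (x j))).2) = a from funext ha]
      · exact fun h => ⟨_, fun _ => rfl, h⟩
    · refine (const False).congr fun w ν V I => ?_
      simp only [QFFormula.Holds, iff_false]
      rintro ⟨a, ha, -⟩
      refine h ?_
      choose x hxy using fun j => Option.map_eq_some_iff.1 (ha j)
      exact ⟨x, fun j => (hxy j).1⟩

end Definable

/-! ### Nested scopes -/

/-- The predicate `S_X₍ₖ₋₁₎ ∃ x₍ₖ₋₁₎ (… S_X₀ ∃ x₀ (pin₀ ∧ P))`, where `pinᵢ` constrains `xᵢ` in the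
scope where it is quantified. -/
def NestedScopes {l : ℕ} : (k : ℕ) → (Fin k → Fin l) → (Fin k → WordPred U σ 1 l) →
    WordPred U σ k l → WordPred U σ 0 l
  | 0, _, _, P => P
  | k + 1, X, pin, P => NestedScopes k (fun i => X i.succ) (fun i => pin i.succ)
      fun w ν V I => ∀ J ∈ subs I (V (X 0)), ∃ p ∈ Set.Ico J.1 J.2,
        pin 0 w (fun _ => p) V J ∧ P w (Fin.cons p ν) V J

namespace NestedScopes

variable {l : ℕ}

/-- No negation surrounds the quantifiers of these variables, so none of them is nested. A pin
occurs below the quantifiers of outer levels, hence its definability in contexts of every size. -/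
theorem definable (k : ℕ) (X : Fin k → Fin l) (pin : Fin k → WordPred U σ 1 l)
    (P : WordPred U σ k l) (hP : Definable 𝔸 False (fun _ => False) P)
    (hpin : ∀ i j, Definable 𝔸 False (fun _ => False)
      (fun w (ν : Fin (j + 1) → ℕ) V I => pin i w (fun _ => ν 0) V I)) :
    Definable 𝔸 False Fin.elim0 (NestedScopes k X pin P) := by
  induction k with
  | zero => rwa [show (Fin.elim0 : Fin 0 → Prop) = fun _ => False from Subsingleton.elim _ _]
  | succ k ih =>
    refine ih _ _ _ (Definable.congr (Definable.segEx (P := fun w ν V I =>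
      pin 0 w (fun _ => ν 0) V I ∧ P w ν V I) ?_ (X 0)) fun w ν V I => by simp) fun i j => hpin _ j
    rw [show (Fin.cons False (fun _ => False) : Fin (k + 1) → Prop) = fun _ => False from
      funext <| Fin.cases (by simp) (by simp)]
    exact (hpin 0 k).and hP

/-- The scopes around `m` are followed inwards, from the outermost level to level 0. -/
theorem exists_of_mem (k : ℕ) (X : Fin k → Fin l) (pin : Fin k → WordPred U σ 1 l)
    (P : WordPred U σ k l) (w : ℕ → σ × U) (V : Fin l → Set ℕ) (I : Scope)
    (h : NestedScopes k X pin P w Fin.elim0 V I) (m : ℕ) (h1 : I.1 ≤ m) (h2 : m < I.2) :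
    ∃ (ν : Fin k → ℕ) (J : Scope), J.1 ≤ m ∧ m < J.2 ∧ P w ν V J ∧
      ∀ i, ∃ J' : Scope, J'.1 ≤ m ∧ m < J'.2 ∧ J'.1 ≤ ν i ∧ ν i < J'.2 ∧
        pin i w (fun _ => ν i) V J' := by
  induction k with
  | zero => exact ⟨_, I, h1, h2, h, fun i => i.elim0⟩
  | succ k ih =>
    obtain ⟨ν, J, h3, h4, h5, h6⟩ := ih _ _ _ h
    obtain ⟨J', h7, h8, h9⟩ := exists_mem_subs (V (X 0)) h3 h4
    obtain ⟨p, hp, h10, h11⟩ := h5 J' h7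
    exact ⟨Fin.cons p ν, J', h8, h9, h11, Fin.cases ⟨J', h8, h9, hp.1, hp.2, h10⟩ h6⟩

/-- `use i m p` expresses that transition `m` needs `xᵢ = p`. Since cuts of level `i` do not
separate uses of levels up to `i` from their positions, a position needed by an inner level survives
all outer cuts. By `huniq` at most one position is needed per scope of level `i`, and `xᵢ` takes it.
The predicate `inner` serves the induction: it collects the uses of levels that have been moved into
the body. -/
theorem of_uses (k : ℕ) (X : Fin k → Fin l) (pin : Fin k → WordPred U σ 1 l)
    (P : WordPred U σ k l) (w : ℕ → σ × U) (V : Fin l → Set ℕ) (I : Scope) (hI : I.1 < I.2)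
    (use : Fin k → ℕ → ℕ → Prop) (inner : ℕ → ℕ → Prop)
    (hin : ∀ m p, I.1 ≤ m → m < I.2 → (inner m p ∨ ∃ i, use i m p) → I.1 ≤ p ∧ p < I.2)
    (hsep : ∀ i i' m p, i' ≤ i → use i' m p → ∀ c ∈ V (X i), ¬ (m < c ∧ c ≤ p) ∧ ¬ (p < c ∧ c ≤ m))
    (hsep' : ∀ i m p, inner m p → ∀ c ∈ V (X i), ¬ (m < c ∧ c ≤ p) ∧ ¬ (p < c ∧ c ≤ m))
    (huniq : ∀ i m m' p p', use i m p → use i m' p' → m ≤ m' →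
      (∀ c ∈ V (X i), ¬ (m < c ∧ c ≤ m')) → p = p')
    (hpin : ∀ i (J : Scope) p, I.1 ≤ J.1 → J.2 ≤ I.2 → J.1 ≤ p → p < J.2 →
      (∀ m p', J.1 ≤ m → m < J.2 → use i m p' → p' = p) → pin i w (fun _ => p) V J)
    (hP : ∀ (J : Scope) ν, I.1 ≤ J.1 → J.1 < J.2 → J.2 ≤ I.2 →
      (∀ m p, J.1 ≤ m → m < J.2 → inner m p → J.1 ≤ p ∧ p < J.2) →
      (∀ i m p, J.1 ≤ m → m < J.2 → use i m p → ν i = p) → P w ν V J) :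
    NestedScopes k X pin P w Fin.elim0 V I := by
  induction k generalizing inner with
  | zero =>
    exact hP I Fin.elim0 le_rfl hI le_rfl (fun m p h1 h2 h3 => hin m p h1 h2 (.inl h3))
      fun i => i.elim0
  | succ k ih =>
    refine ih _ _ _ (fun i => use i.succ) (fun m p => inner m p ∨ use 0 m p) ?_ ?_ ?_ ?_ ?_ ?_
    · rintro m p h1 h2 ((h | h) | ⟨i, h⟩)
      · exact hin m p h1 h2 (.inl h)
      · exact hin m p h1 h2 (.inr ⟨_, h⟩)
      · exact hin m p h1 h2 (.inr ⟨_, h⟩)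
    · exact fun i i' m p hi => hsep i.succ i'.succ m p (Fin.succ_le_succ_iff.2 hi)
    · rintro i m p (h | h)
      · exact hsep' i.succ m p h
      · exact hsep i.succ 0 m p (Fin.zero_le _) h
    · exact fun i => huniq i.succ
    · exact fun i => hpin i.succ
    · intro J ν hJ1 hJ2 hJ3 hJin hJν J' hJ'
      obtain ⟨k1, k2, k3, k4, k5, k6⟩ := (mem_subs_iff hJ2.le).1 hJ'
      have hstay : ∀ m p, J'.1 ≤ m → m < J'.2 → J.1 ≤ p → p < J.2 →
          (∀ c ∈ V (X 0), ¬ (m < c ∧ c ≤ p) ∧ ¬ (p < c ∧ c ≤ m)) → J'.1 ≤ p ∧ p < J'.2 := by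
        intro m p h1 h2 h3 h4 h5
        constructor
        · by_contra h
          rcases k4 with k4 | k4
          · omega
          · exact (h5 _ k4).2 ⟨by omega, h1⟩
        · by_contra h
          rcases k5 with k5 | k5
          · omega
          · exact (h5 _ k5).1 ⟨h2, by omega⟩
      have hex : ∃ p, J'.1 ≤ p ∧ p < J'.2 ∧ ∀ m p', J'.1 ≤ m → m < J'.2 → use 0 m p' → p' = p := by
        by_cases hu : ∃ m p, J'.1 ≤ m ∧ m < J'.2 ∧ use 0 m p
        · obtain ⟨m, p, h1, h2, h3⟩ := hu
          obtain ⟨h4, h5⟩ := hJin m p (by omega) (by omega) (.inr h3)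
          obtain ⟨h6, h7⟩ := hstay m p h1 h2 h4 h5 (hsep 0 0 m p le_rfl h3)
          refine ⟨p, h6, h7, fun m' p' h8 h9 h10 => ?_⟩
          rcases le_total m m' with h | h
          · exact (huniq 0 m m' p p' h3 h10 h fun c hc ⟨h11, h12⟩ =>
              k6 c (by omega) (by omega) hc).symm
          · exact huniq 0 m' m p' p h10 h3 h fun c hc ⟨h11, h12⟩ =>
              k6 c (by omega) (by omega) hc
        -- A scope without uses still has to provide some value of the variable.
        · exact ⟨J'.1, le_rfl, k2, fun m p' h1 h2 h3 => (hu ⟨m, p', h1, h2, h3⟩).elim⟩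
      obtain ⟨p, hp1, hp2, hp3⟩ := hex
      refine ⟨p, ⟨hp1, hp2⟩, hpin 0 J' p (by omega) (by omega) hp1 hp2 hp3,
        hP J' _ (by omega) k2 (by omega) (fun m q h1 h2 h3 => ?_) (fun i m q h1 h2 h3 => ?_)⟩
      · obtain ⟨h4, h5⟩ := hJin m q (by omega) (by omega) (.inl h3)
        exact hstay m q h1 h2 h4 h5 (hsep' 0 m q h3)
      · revert h3
        refine Fin.cases (fun h3 => ?_) (fun i h3 => ?_) i
        · exact (hp3 m q h1 h2 h3).symm
        · exact hJν i m q (by omega) (by omega) h3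

end NestedScopes

/-! ### The sentence of a register automaton -/

/-- Among the elements of `M` in the scope `I`, `x` is the last one below `n` (if `left` is true) or
the first one not below `n` (otherwise). -/
def Near (M : Set ℕ) (I : Scope) (n : ℕ) (left : Bool) (x : ℕ) : Prop :=
  x ∈ M ∧ (x < n ↔ left = true) ∧ ∀ z ∈ Set.Ico I.1 I.2, z ∈ M → (z < n ↔ left = true) →
    ¬ (left = true ∧ x < z) ∧ ¬ (left = false ∧ z < x)

/-- Each scope contains a position adjacent to the boundary `n`. If `x ≠ y`, the one nearer to `n`
lies between the other and `n`, hence in the scope of the other, and contradicts that the other is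
nearest. So a register content found at boundary `n` is the same for the transitions on both sides,
in all scopes and conjuncts. -/
theorem Near.eq {M : Set ℕ} {I I' : Scope} {m m' n : ℕ} {left : Bool} {x y : ℕ}
    (hx : Near M I n left x) (hy : Near M I' n left y) (hm : n = m ∨ n = m + 1)
    (hm' : n = m' ∨ n = m' + 1) (h1 : I.1 ≤ m) (h2 : m < I.2)
    (h3 : I.1 ≤ x) (h4 : x < I.2) (h1' : I'.1 ≤ m') (h2' : m' < I'.2) (h3' : I'.1 ≤ y)
    (h4' : y < I'.2) : x = y := by
  obtain ⟨hx1, hx2, hx3⟩ := hx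
  obtain ⟨hy1, hy2, hy3⟩ := hy
  have k1 : y ∈ Set.Ico I.1 I.2 → ¬ (left = true ∧ x < y) ∧ ¬ (left = false ∧ y < x) :=
    fun h => hx3 y h hy1 hy2
  have k2 : x ∈ Set.Ico I'.1 I'.2 → ¬ (left = true ∧ y < x) ∧ ¬ (left = false ∧ x < y) :=
    fun h => hy3 x h hx1 hx2
  simp only [Set.mem_Ico] at k1 k2
  cases left <;> simp at * <;> omega

theorem Definable.near {k l : ℕ} {b : Prop} {nested : Fin k → Prop} (X : Fin l) (left s : Bool)
    (m x : Fin k) : Definable 𝔸 b nested (fun (_ : ℕ → σ × U) ν (V : Fin l → Set ℕ) J =>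
      Near (V X) J (ν m + s.toNat) left (ν x)) := by
  have hlt {k : ℕ} {b : Prop} {nested : Fin k → Prop} (x m : Fin k) : Definable 𝔸 b nested
      (fun (_ : ℕ → σ × U) ν (_ : Fin l → Set ℕ) _ => ν x < ν m + s.toNat) := by
    cases s
    · exact .lt x m
    · exact (Definable.not (.lt m x)).congr fun w ν V I => by simp
  refine (Definable.mem X x).and (((hlt x m).iff (.const _)).and ?_)
  exact Definable.all (P := fun w ν V J => ν 0 ∈ V X → (ν 0 < ν m.succ + s.toNat ↔ left = true) →
    ¬ (left = true ∧ ν x.succ < ν 0) ∧ ¬ (left = false ∧ ν 0 < ν x.succ))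
    ((Definable.mem X 0).imp (((hlt 0 m.succ).iff (.const _)).imp
      ((Definable.not ((Definable.const _).and (.lt _ _))).and
        (.not ((Definable.const _).and (.lt _ _))))))

theorem Definable.exists_finite {k l : ℕ} {b : Prop} {nested : Fin k → Prop} {ι : Type*} [Finite ι]
    {P : ι → WordPred U σ k l} (h : ∀ i, Definable 𝔸 True nested (P i)) :
    Definable 𝔸 b nested (fun w ν V I => ∃ i, P i w ν V I) :=
  (Definable.not (.forall_finite fun i => (h i).not)).congr fun _ _ _ _ => by simp

namespace NRA

/-- Where the contents of registers are found: `some (i, left)` points to the nearest position on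
the given side that is marked with `i`, and `none` stands for `nil`. -/
abbrev Pointers (A : NRA σ 𝔸) (K : ℕ) : Type := A.R → Option (Fin K × Bool)

/-- The label of a transition in a run: a rule, pointers to the contents of the registers before and
after the transition, and the phase of every level. -/
abbrev RunLabel (A : NRA σ 𝔸) (K : ℕ) : Type v :=
  A.rules × A.Pointers K × A.Pointers K × (Fin K → Fin 3)

/-- The sets that encode a run: those of transitions with a given label, those of positions that are
marked with a given level, and for every level three sets of scope boundaries. -/
abbrev SetIndex (A : NRA σ 𝔸) (K : ℕ) : Type v :=
  A.RunLabel K ⊕ Fin K ⊕ (Fin 3 × Fin K)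

/-- The register contents that are found at the positions `ν`. -/
def pointerVal (A : NRA σ 𝔸) {K : ℕ} (w : ℕ → σ × U) (ν : Fin K → ℕ) (f : A.Pointers K) (r : A.R) :
    Option U :=
  (f r).map fun p => (w (ν p.1)).2

/-- The condition on the position to which the level `i` points, for transitions with the
phases `c`. -/
def PointerCond (A : NRA σ 𝔸) {K l : ℕ} (e : A.SetIndex K → Fin l) (c : Fin K → Fin 3) (i : Fin K) :
    WordPred U σ 1 l := fun _ ν V J =>
  ∀ m ∈ Set.Ico J.1 J.2, ∀ θ : A.RunLabel K, m ∈ V (e (.inl θ)) → θ.2.2.2 = c → ∀ r left,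
    (θ.2.1 r = some (i, left) →
      Near (V (e (.inr (.inl i)))) J (m + Bool.toNat false) left (ν 0)) ∧
    (θ.2.2.1 r = some (i, left) →
      Near (V (e (.inr (.inl i)))) J (m + Bool.toNat true) left (ν 0))

/-- The condition on transitions with the phases `c`. -/
def RuleCond (A : NRA σ 𝔸) {K l : ℕ} (e : A.SetIndex K → Fin l) (c : Fin K → Fin 3) :
    WordPred U σ K l := fun w ν V J =>
  ∀ m ∈ Set.Ico J.1 J.2, ∀ θ : A.RunLabel K, m ∈ V (e (.inl θ)) → θ.2.2.2 = c →
    (w m).1 = θ.1.1.2.1 ∧ θ.1.1.2.2.1.Holds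
      (constrVal (A.pointerVal w ν θ.2.1) (w m).2 (A.pointerVal w ν θ.2.2.1))

/-- The sets `V` encode an accepting run. -/
structure Labelled (A : NRA σ 𝔸) {K l : ℕ} (e : A.SetIndex K → Fin l) (w : ℕ → σ × U)
    (V : Fin l → Set ℕ) (I : Scope) : Prop where
  total : ∀ m ∈ Set.Ico I.1 I.2, ∃ θ, m ∈ V (e (.inl θ))
  first : ∀ m ∈ Set.Ico I.1 I.2, (∀ z ∈ Set.Ico I.1 I.2, ¬ z < m) → ∀ θ : A.RunLabel K,
    m ∈ V (e (.inl θ)) → θ.1.1.1 ∈ A.initial ∧ ∀ r, θ.2.1 r = none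
  last : ∀ m ∈ Set.Ico I.1 I.2, (∀ z ∈ Set.Ico I.1 I.2, ¬ m < z) → ∀ θ : A.RunLabel K,
    m ∈ V (e (.inl θ)) → θ.1.1.2.2.2 ∈ A.accepting
  next : ∀ m ∈ Set.Ico I.1 I.2, ∀ m' ∈ Set.Ico I.1 I.2,
    (m < m' ∧ ∀ z ∈ Set.Ico I.1 I.2, ¬ (m < z ∧ z < m')) →
    ∀ θ θ' : A.RunLabel K, m ∈ V (e (.inl θ)) → m' ∈ V (e (.inl θ')) →
      θ.1.1.2.2.2 = θ'.1.1.1 ∧ θ.2.2.1 = θ'.2.1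
  nested : ∀ c, NestedScopes K (fun i => e (.inr (.inr (c i, i)))) (A.PointerCond e c)
    (A.RuleCond e c) w Fin.elim0 V I

theorem definable_pointerCond (A : NRA σ 𝔸) {K l : ℕ} (e : A.SetIndex K → Fin l)
    (c : Fin K → Fin 3) (i : Fin K) (j : ℕ) :
    Definable 𝔸 False (fun _ => False)
      (fun w (ν : Fin (j + 1) → ℕ) V I => A.PointerCond e c i w (fun _ => ν 0) V I) := by
  have _ := A.finite_R
  have _ := A.finite_rules.to_subtype
  refine Definable.all (P := fun _ ν V J => ∀ θ : A.RunLabel K, ν 0 ∈ V (e (.inl θ)) →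
    θ.2.2.2 = c → ∀ r left, (θ.2.1 r = some (i, left) →
      Near (V (e (.inr (.inl i)))) J (ν 0 + Bool.toNat false) left (ν (Fin.succ 0))) ∧
    (θ.2.2.1 r = some (i, left) →
      Near (V (e (.inr (.inl i)))) J (ν 0 + Bool.toNat true) left (ν (Fin.succ 0)))) ?_
  refine .forall_finite fun θ => .imp (.mem _ _) (.imp (.const _) (.forall_finite fun r =>
    .forall_finite fun left => .and (.imp (.const _) ?_) (.imp (.const _) ?_)))
  · exact .near _ left false 0 (Fin.succ 0)
  · exact .near _ left true 0 (Fin.succ 0)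

/-- The transition `m`, with index `0`, is the only nested variable, so every data atom is
admissible, whatever registers it compares. -/
theorem definable_ruleCond (A : NRA σ 𝔸) {K l : ℕ} (e : A.SetIndex K → Fin l) (c : Fin K → Fin 3) :
    Definable 𝔸 False (fun _ => False) (A.RuleCond e c) := by
  have _ := A.finite_R
  have _ := A.finite_rules.to_subtype
  let f (θ : A.RunLabel K) : ConstrVar A.R → Option (Fin (K + 1))
    | .input => some 0
    | .pre r => (θ.2.1 r).map fun p => p.1.succ
    | .post r => (θ.2.2.1 r).map fun p => p.1.succ
  have h : Definable 𝔸 False (fun _ => False) (fun (w : ℕ → σ × U) ν V J =>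
      ∀ m ∈ Set.Ico J.1 J.2, ∀ θ : A.RunLabel K, m ∈ V (e (.inl θ)) → θ.2.2.2 = c →
        (w m).1 = θ.1.1.2.1 ∧ θ.1.1.2.2.1.Holds (fun y => (f θ y).map fun x =>
          (w ((Fin.cons m ν : Fin (K + 1) → ℕ) x)).2)) := by
    refine Definable.all (P := fun w ν V J => ∀ θ : A.RunLabel K, ν 0 ∈ V (e (.inl θ)) →
      θ.2.2.2 = c → (w (ν 0)).1 = θ.1.1.2.1 ∧ θ.1.1.2.2.1.Holds (fun y => (f θ y).map fun x =>
          (w (ν x)).2)) ?_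
    refine .forall_finite fun θ => .imp (.mem _ _) (.imp (.const _) (.and (.letter _ _)
      (.holds _ _ fun y z => ?_)))
    refine Fin.cases ?_ (fun y => ?_) y <;> refine Fin.cases ?_ (fun z => ?_) z <;> simp
  refine h.congr fun w ν V J => ?_
  refine forall₂_congr fun m _ => forall_congr' fun θ => imp_congr_right fun _ =>
    imp_congr_right fun _ => and_congr_right fun _ => iff_of_eq (congrArg (QFFormula.Holds · _) ?_)
  funext y
  cases y with
  | input => rfl
  | pre r => simp only [constrVal, pointerVal, f, Option.map_map]; rfl
  | post r => simp only [constrVal, pointerVal, f, Option.map_map]; rfl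

theorem exists_labelled_sentence (A : NRA σ 𝔸) {K l : ℕ} (e : A.SetIndex K → Fin l) :
    ∃ φ : Formula σ 𝔸 0 0, φ.WellFormed ∧ ∀ w I, φ.NSat w Fin.elim0 Fin.elim0 I ↔
      ∃ V, (∀ X, V X ⊆ Set.Ico I.1 I.2) ∧ A.Labelled e w V I := by
  have _ := A.finite_R
  have _ := A.finite_rules.to_subtype
  have h : Definable 𝔸 False Fin.elim0 (fun w _ V I => A.Labelled e w V I) := by
    have h1 : Definable 𝔸 False Fin.elim0 (fun (_ : ℕ → σ × U) _ V I =>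
        ∀ m ∈ Set.Ico I.1 I.2, ∃ θ : A.RunLabel K, m ∈ V (e (.inl θ))) :=
      Definable.all (P := fun _ ν V _ => ∃ θ : A.RunLabel K, ν 0 ∈ V (e (.inl θ)))
        (.exists_finite fun θ => .mem _ _)
    have h2 : Definable 𝔸 False Fin.elim0 (fun (_ : ℕ → σ × U) _ V I =>
        ∀ m ∈ Set.Ico I.1 I.2, (∀ z ∈ Set.Ico I.1 I.2, ¬ z < m) → ∀ θ : A.RunLabel K,
          m ∈ V (e (.inl θ)) → θ.1.1.1 ∈ A.initial ∧ ∀ r, θ.2.1 r = none) :=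
      Definable.all (P := fun _ ν V I => (∀ z ∈ Set.Ico I.1 I.2, ¬ z < ν 0) →
        ∀ θ : A.RunLabel K, ν 0 ∈ V (e (.inl θ)) → θ.1.1.1 ∈ A.initial ∧ ∀ r, θ.2.1 r = none)
        (.imp (Definable.all (P := fun _ ν _ _ => ¬ ν 0 < ν (Fin.succ 0)) (.not (.lt _ _)))
          (.forall_finite fun θ => .imp (.mem _ _) (.const _)))
    have h3 : Definable 𝔸 False Fin.elim0 (fun (_ : ℕ → σ × U) _ V I =>
        ∀ m ∈ Set.Ico I.1 I.2, (∀ z ∈ Set.Ico I.1 I.2, ¬ m < z) → ∀ θ : A.RunLabel K,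
          m ∈ V (e (.inl θ)) → θ.1.1.2.2.2 ∈ A.accepting) :=
      Definable.all (P := fun _ ν V I => (∀ z ∈ Set.Ico I.1 I.2, ¬ ν 0 < z) →
        ∀ θ : A.RunLabel K, ν 0 ∈ V (e (.inl θ)) → θ.1.1.2.2.2 ∈ A.accepting)
        (.imp (Definable.all (P := fun _ ν _ _ => ¬ ν (Fin.succ 0) < ν 0) (.not (.lt _ _)))
          (.forall_finite fun θ => .imp (.mem _ _) (.const _)))
    have h4 : Definable 𝔸 False Fin.elim0 (fun (_ : ℕ → σ × U) _ V I =>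
        ∀ m ∈ Set.Ico I.1 I.2, ∀ m' ∈ Set.Ico I.1 I.2,
        (m < m' ∧ ∀ z ∈ Set.Ico I.1 I.2, ¬ (m < z ∧ z < m')) →
        ∀ θ θ' : A.RunLabel K, m ∈ V (e (.inl θ)) → m' ∈ V (e (.inl θ')) →
          θ.1.1.2.2.2 = θ'.1.1.1 ∧ θ.2.2.1 = θ'.2.1) :=
      Definable.all (P := fun _ ν V I => ∀ m' ∈ Set.Ico I.1 I.2,
        (ν 0 < m' ∧ ∀ z ∈ Set.Ico I.1 I.2, ¬ (ν 0 < z ∧ z < m')) →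
        ∀ θ θ' : A.RunLabel K, ν 0 ∈ V (e (.inl θ)) → m' ∈ V (e (.inl θ')) →
          θ.1.1.2.2.2 = θ'.1.1.1 ∧ θ.2.2.1 = θ'.2.1) <|
      Definable.all (P := fun _ ν V I =>
        (ν (Fin.succ 0) < ν 0 ∧ ∀ z ∈ Set.Ico I.1 I.2, ¬ (ν (Fin.succ 0) < z ∧ z < ν 0)) →
        ∀ θ θ' : A.RunLabel K, ν (Fin.succ 0) ∈ V (e (.inl θ)) → ν 0 ∈ V (e (.inl θ')) →
          θ.1.1.2.2.2 = θ'.1.1.1 ∧ θ.2.2.1 = θ'.2.1) <|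
      .imp (.and (.lt _ _) (Definable.all
        (P := fun _ ν _ _ => ¬ (ν (Fin.succ (Fin.succ 0)) < ν 0 ∧ ν 0 < ν (Fin.succ 0)))
        (.not (.and (.lt _ _) (.lt _ _)))))
        (.forall_finite fun θ => .forall_finite fun θ' =>
          .imp (.mem _ _) (.imp (.mem _ _) (.const _)))
    have h5 : Definable 𝔸 False Fin.elim0 (fun (w : ℕ → σ × U) ν V I =>
        ∀ c, NestedScopes K (fun i => e (.inr (.inr (c i, i)))) (A.PointerCond e c)
          (A.RuleCond e c) w ν V I) :=
      .forall_finite fun c => NestedScopes.definable K _ _ _ (A.definable_ruleCond e c)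
        (A.definable_pointerCond e c)
    refine (h1.and (h2.and (h3.and (h4.and h5)))).congr fun w ν V I => ?_
    rw [Subsingleton.elim ν Fin.elim0]
    exact ⟨fun ⟨h1, h2, h3, h4, h5⟩ => ⟨h1, h2, h3, h4, h5⟩,
      fun ⟨h1, h2, h3, h4, h5⟩ => ⟨h1, h2, h3, h4, h5⟩⟩
  obtain ⟨φ, h1, h2⟩ := h.exSets
  exact ⟨φ, h1, fun w I => h2 w _ _ I⟩

end NRA

/-! ### Decoding a labelling into an accepting run -/

namespace NRA

/-- The contents of a register at boundary `b` are read off at the marked position to which its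
pointer leads. Adjacent transitions have equal pointers at their common boundary, so by `Near.eq`
they see equal contents, and each transition satisfies its rule in the conjunct for its own phases.
-/
theorem Labelled.mem_language {A : NRA σ 𝔸} {K l : ℕ} {e : A.SetIndex K → Fin l}
    {w : List (σ × U)} (hw : 0 < w.length) {V : Fin l → Set ℕ}
    (h : A.Labelled e (extendWord w hw) V (0, w.length)) : w ∈ A.language := by
  classical
  have hθ (m : ℕ) : ∃ θ, m < w.length → m ∈ V (e (.inl θ)) := by
    by_cases hm : m < w.length
    · obtain ⟨θ, hθ⟩ := h.total m ⟨Nat.zero_le _, hm⟩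
      exact ⟨θ, fun _ => hθ⟩
    · obtain ⟨θ, -⟩ := h.total 0 ⟨le_rfl, hw⟩
      exact ⟨θ, fun h => (hm h).elim⟩
  choose θ hθ using hθ
  -- `dec b i left` is the position found from boundary `b` in any scope. If no scope finds one, the
  -- value `0` is never used.
  have hdec (b : ℕ) (i : Fin K) (left : Bool) : ∃ x, ∀ y J m, (b = m ∨ b = m + 1) → J.1 ≤ m →
      m < J.2 → J.1 ≤ y → y < J.2 → Near (V (e (.inr (.inl i)))) J b left y → x = y := by
    by_cases hx : ∃ x J m, (b = m ∨ b = m + 1) ∧ J.1 ≤ m ∧ m < J.2 ∧ J.1 ≤ x ∧ x < J.2 ∧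
        Near (V (e (.inr (.inl i)))) J b left x
    · obtain ⟨x, J, m, h1, h2, h3, h4, h5, h6⟩ := hx
      exact ⟨x, fun y J' m' h1' h2' h3' h4' h5' h6' =>
        h6.eq h6' h1 h1' h2 h3 h4 h5 h2' h3' h4' h5'⟩
    · exact ⟨0, fun y J m h1 h2 h3 h4 h5 h6 => (hx ⟨y, J, m, h1, h2, h3, h4, h5, h6⟩).elim⟩
  choose dec hdec using hdec
  let ptr (b : ℕ) : A.Pointers K := if b = 0 then fun _ => none else (θ (b - 1)).2.2.1
  let st (b : ℕ) : A.Q := if b = 0 then (θ 0).1.1.1 else (θ (b - 1)).1.1.2.2.2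
  let reg (b : ℕ) (r : A.R) : Option U :=
    (ptr b r).map fun p => (extendWord w hw (dec b p.1 p.2)).2
  have hpre (m : ℕ) (hm : m < w.length) : (θ m).1.1.1 = st m ∧ (θ m).2.1 = ptr m := by
    rcases m with _ | m
    · exact ⟨rfl, funext (h.first 0 ⟨le_rfl, hw⟩ (fun _ _ => Nat.not_lt_zero _) _ (hθ 0 hw)).2⟩
    · obtain ⟨h1, h2⟩ := h.next m ⟨Nat.zero_le _, by dsimp; omega⟩ (m + 1) ⟨Nat.zero_le _, hm⟩
        ⟨by omega, fun z _ => by omega⟩ (θ m) (θ (m + 1)) (hθ m (by omega)) (hθ _ hm)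
      exact ⟨h1.symm, h2.symm⟩
  refine ⟨fun b => (st b, reg b), ?_, fun r => rfl, fun i => ?_, ?_⟩
  · exact (h.first 0 ⟨le_rfl, hw⟩ (fun _ _ => Nat.not_lt_zero _) _ (hθ 0 hw)).1
  · obtain ⟨m, hm⟩ := i
    obtain ⟨ν, J, hJ1, hJ2, hrule, hpin⟩ := NestedScopes.exists_of_mem K _ _ _ _ _ _
      (h.nested (θ m).2.2.2) m (Nat.zero_le _) hm
    obtain ⟨h1, h2⟩ := hrule m ⟨hJ1, hJ2⟩ (θ m) (hθ m hm) rfl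
    obtain ⟨hst, hptr⟩ := hpre m hm
    have hpost : (θ m).2.2.1 = ptr (m + 1) := rfl
    have k1 : A.pointerVal (extendWord w hw) ν (θ m).2.1 = reg m := by
      funext r
      simp only [pointerVal, reg, hptr]
      refine Option.map_congr fun p hp => ?_
      obtain ⟨J', h3, h4, h5, h6, h7⟩ := hpin p.1
      have h8 := (h7 m ⟨h3, h4⟩ (θ m) (hθ m hm) rfl r p.2).1 (by rw [hptr]; exact hp)
      rw [hdec m p.1 p.2 _ J' m (.inl rfl) h3 h4 h5 h6 h8]
    have k2 : A.pointerVal (extendWord w hw) ν (θ m).2.2.1 = reg (m + 1) := by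
      funext r
      simp only [pointerVal, reg, hpost]
      refine Option.map_congr fun p hp => ?_
      obtain ⟨J', h3, h4, h5, h6, h7⟩ := hpin p.1
      have h8 := (h7 m ⟨h3, h4⟩ (θ m) (hθ m hm) rfl r p.2).2 (by rw [hpost]; exact hp)
      rw [hdec (m + 1) p.1 p.2 _ J' m (.inr rfl) h3 h4 h5 h6 h8]
    rw [k1, k2] at h2
    rw [show extendWord w hw m = w.get ⟨m, hm⟩ from extendWord_fin w hw ⟨m, hm⟩] at h1 h2
    refine ⟨(θ m).1.1.2.2.1, ?_, h2⟩
    change (st m, (w.get ⟨m, hm⟩).1, (θ m).1.1.2.2.1, (θ m).1.1.2.2.2) ∈ A.rules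
    rw [← hst, h1]
    exact (θ m).1.2
  · have h1 : st w.length = (θ (w.length - 1)).1.1.2.2.2 := if_neg hw.ne'
    change st w.length ∈ A.accepting
    rw [h1]
    exact h.last (w.length - 1) ⟨Nat.zero_le _, by dsimp; omega⟩
      (fun z hz => by have := hz.2; dsimp at this; omega) _ (hθ _ (by omega))

/-! ### Witnesses of stored values -/

/-- Some register stores `ξ` before the transition number `b`, or at the end if `b = n`. -/
def StoredAt (A : NRA σ 𝔸) (c : ℕ → A.Conf) (n b : ℕ) (ξ : U) : Prop :=
  b ≤ n ∧ ∃ r, (c b).2 r = some ξ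

/-- Let boundaries `a, …, f - 1` be the maximal stretch around `b` where `ξ` is stored. Registers
are initially `nil`, so `a > 0`, and transition `a - 1` either reads `ξ` or guesses it; in the
latter case weak guessing provides a later read in the live interval. Transition `p` ends at
boundary `p + 1`. -/
theorem WeaklyGuessing.exists_read {A : NRA σ 𝔸} (hA : A.WeaklyGuessing) {n : ℕ}
    {w : Fin n → σ × U} {c : Fin (n + 1) → A.Conf} (hc : A.IsAcceptingRun w c)
    (w' : ℕ → σ × U) (hw' : ∀ i : Fin n, w' i = w i)
    (c' : ℕ → A.Conf) (hc' : ∀ b : Fin (n + 1), c' b = c b) {b : ℕ} {ξ : U}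
    (hb : A.StoredAt c' n b ξ) :
    ∃ p < n, (w' p).2 = ξ ∧ ∀ b', (b ≤ b' ∧ b' ≤ p + 1 ∨ p + 1 ≤ b' ∧ b' ≤ b) →
      A.StoredAt c' n b' ξ := by
  classical
  have hstores (i : Fin n) : A.Stores c i ξ ↔ A.StoredAt c' n (i + 1) ξ := by
    have := hc' i.succ
    rw [Fin.val_succ] at this
    exact ⟨fun ⟨r, hr⟩ => ⟨i.2, r, by rw [this]; exact hr⟩,
      fun ⟨_, r, hr⟩ => ⟨r, by rw [this] at hr; exact hr⟩⟩
  have h0 : ¬ A.StoredAt c' n 0 ξ := by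
    rintro ⟨-, r, hr⟩
    have h1 := hc' 0
    rw [Fin.val_zero] at h1
    rw [h1, hc.initial_nil] at hr
    simp at hr
  have hex : ∃ a ≤ b, ∀ x, a ≤ x → x ≤ b → A.StoredAt c' n x ξ :=
    ⟨b, le_rfl, fun x h1 h2 => (le_antisymm h1 h2) ▸ hb⟩
  obtain ⟨ha1, ha2⟩ := Nat.find_spec hex
  have ha3 : ¬ A.StoredAt c' n (Nat.find hex - 1) ξ := fun h => by
    by_cases ha : Nat.find hex = 0
    · rw [ha] at h
      exact h0 h
    · refine Nat.find_min hex (m := Nat.find hex - 1) (by omega) ⟨by omega, fun x h1 h2 => ?_⟩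
      by_cases hx : x = Nat.find hex - 1
      · exact hx ▸ h
      · exact ha2 x (by omega) h2
  generalize Nat.find hex = a at ha1 ha2 ha3
  have ha0 : 0 < a := by
    by_contra h
    exact h0 (ha2 0 (by omega) (by omega))
  have hex' : ∃ x, b < x ∧ ¬ A.StoredAt c' n x ξ :=
    ⟨n + 1, by have := hb.1; omega, fun h => by have := h.1; omega⟩
  obtain ⟨hf1, hf2⟩ := Nat.find_spec hex'
  have hf3 : ∀ x, b < x → x < Nat.find hex' → A.StoredAt c' n x ξ := fun x h1 h2 => by
    by_contra h
    exact Nat.find_min hex' h2 ⟨h1, h⟩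
  have hfn : Nat.find hex' ≤ n + 1 := Nat.find_min' hex'
    ⟨by have := hb.1; omega, fun h => by have := h.1; omega⟩
  generalize Nat.find hex' = f at hf1 hf2 hf3 hfn
  have hall : ∀ x, a ≤ x → x < f → A.StoredAt c' n x ξ := fun x h1 h2 => by
    by_cases hx : x ≤ b
    · exact ha2 x h1 hx
    · exact hf3 x (by omega) h2
  suffices h : ∃ p : Fin n, a ≤ p + 1 ∧ p + 1 < f ∧ (w p).2 = ξ by
    obtain ⟨p, h1, h2, h3⟩ := h
    exact ⟨p, p.2, by rw [hw', h3], fun b' hb' => hall b' (by omega) (by omega)⟩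
  let i : Fin n := ⟨a - 1, by omega⟩
  have hi : (i : ℕ) + 1 = a := by simp only [i]; omega
  by_cases hr : (w i).2 = ξ
  · exact ⟨i, hi.ge, by omega, hr⟩
  by_contra hno
  -- Boundary `f` is the first without `ξ`, so the live interval ends with transition `f - 2`, which
  -- leads to boundary `f - 1`.
  refine hA n w c hc i ξ ⟨⟨(hstores i).2 (hall _ (by omega) (by omega)), fun r hr' => ha3 ?_, hr⟩,
    ⟨f - 2, by omega⟩, ⟨Fin.mk_le_mk.2 (by omega), fun m h1 h2 => ?_, fun m hm h => ?_⟩,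
    fun m h1 h2 h3 => hno ?_⟩
  · refine ⟨by omega, r, ?_⟩
    have h1 := hc' i.castSucc
    rw [Fin.val_castSucc] at h1
    rw [show a - 1 = (i : ℕ) from rfl, h1]
    exact hr'
  · rw [Fin.le_def] at h1 h2
    exact (hstores m).2 (hall _ (by omega) (by dsimp at h2; omega))
  · have h1 := (hstores m).1 h
    rw [show (m : ℕ) + 1 = f by dsimp at hm; omega] at h1
    exact hf2 h1
  · rw [Fin.le_def] at h1 h2
    exact ⟨m, by omega, by dsimp at h2; omega, h3⟩

/-- Every stored value has a witness, i.e. a position where it is read, such that the witness does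
not change while the value is stored, and such that the value is stored at its witness. -/
theorem WeaklyGuessing.exists_witness {A : NRA σ 𝔸} (hA : A.WeaklyGuessing) {n : ℕ}
    {w : Fin n → σ × U} {c : Fin (n + 1) → A.Conf} (hc : A.IsAcceptingRun w c)
    (w' : ℕ → σ × U) (hw' : ∀ i : Fin n, w' i = w i)
    (c' : ℕ → A.Conf) (hc' : ∀ b : Fin (n + 1), c' b = c b) :
    ∃ wit : ℕ → U → ℕ, ∀ b ξ, A.StoredAt c' n b ξ → wit b ξ < n ∧ (w' (wit b ξ)).2 = ξ ∧
      ∀ b', (b ≤ b' ∧ b' ≤ wit b ξ + 1 ∨ wit b ξ + 1 ≤ b' ∧ b' ≤ b) →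
        A.StoredAt c' n b' ξ ∧ wit b' ξ = wit b ξ := by
  -- The candidates depend only on the stretch of boundaries that stores `ξ` around `b`, by `hsub`;
  -- hence their least element does not change along it.
  let W (b : ℕ) (ξ : U) : Set ℕ := {p | p < n ∧ (w' p).2 = ξ ∧
    ∀ b', (b ≤ b' ∧ b' ≤ p + 1 ∨ p + 1 ≤ b' ∧ b' ≤ b) → A.StoredAt c' n b' ξ}
  have hsub (b b' ξ) (h : ∀ x, (b ≤ x ∧ x ≤ b' ∨ b' ≤ x ∧ x ≤ b) → A.StoredAt c' n x ξ) :
      W b ξ ⊆ W b' ξ := by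
    rintro p ⟨h1, h2, h3⟩
    refine ⟨h1, h2, fun x hx => ?_⟩
    by_cases hx' : b ≤ x ∧ x ≤ b' ∨ b' ≤ x ∧ x ≤ b
    · exact h x hx'
    · exact h3 x (by omega)
  refine ⟨fun b ξ => sInf (W b ξ), fun b ξ hb => ?_⟩
  obtain ⟨h1, h2, h3⟩ : sInf (W b ξ) ∈ W b ξ := Nat.sInf_mem (by
    obtain ⟨p, h1, h2⟩ := hA.exists_read hc w' hw' c' hc' hb
    exact ⟨p, h1, h2⟩)
  refine ⟨h1, h2, fun b' hb' => ⟨h3 b' hb', ?_⟩⟩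
  dsimp only at hb' ⊢
  rw [(hsub b b' ξ fun x hx => h3 x (by omega)).antisymm (hsub b' b ξ fun x hx => h3 x (by omega))]

end NRA

/-! ### Encoding an accepting run by sets -/

theorem exists_block_start {J : ℕ → ℕ} (hJ : ∀ m, J (m + 1) = J m ∨ J (m + 1) = J m + 1)
    {m m' j : ℕ}
    (hm : m ≤ m') (h1 : J m < j) (h2 : j ≤ J m') :
    ∃ x, m < x ∧ x ≤ m' ∧ J x = j ∧ J (x - 1) ≠ J x := by
  induction m', hm using Nat.le_induction with
  | base => omega
  | succ m' hm ih =>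
    by_cases h : j ≤ J m'
    · obtain ⟨x, h3, h4, h5⟩ := ih h
      exact ⟨x, h3, by omega, h5⟩
    · have := hJ m'
      refine ⟨m' + 1, by omega, le_rfl, by omega, ?_⟩
      rw [Nat.add_sub_cancel]
      omega

namespace NRA

/-- The number of levels that is needed to encode runs. -/
noncomputable def numLevels (A : NRA σ 𝔸) : ℕ := 3 * Nat.card (Bool × A.R)

/-- The witnesses in use at transitions form a token family, and its levels and blocks give the
markings and the cuts. The conditions in nested scopes then follow from `NestedScopes.of_uses`,
where a transition of the given phases uses exactly its witnesses. -/
theorem WeaklyGuessing.exists_labelled {A : NRA σ 𝔸} (hA : A.WeaklyGuessing) {l : ℕ}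
    (e : A.SetIndex A.numLevels ≃ Fin l) {w : List (σ × U)} (hw : 0 < w.length)
    (hwA : w ∈ A.language) :
    ∃ V, (∀ X, V X ⊆ Set.Ico 0 w.length) ∧
      A.Labelled e (extendWord w hw) V (0, w.length) := by
  classical
  have _ := A.finite_R
  obtain ⟨c₀, hc₀⟩ := hwA
  let c (b : ℕ) : A.Conf := if h : b < w.length + 1 then c₀ ⟨b, h⟩ else c₀ 0
  have hc : ∀ b : Fin (w.length + 1), c b = c₀ b := fun b => dif_pos b.2
  obtain ⟨wit, hwit⟩ := hA.exists_witness hc₀ (extendWord w hw) (extendWord_fin w hw) c hc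
  have hstep : ∀ m < w.length, A.Step (c m) (extendWord w hw m) (c (m + 1)) := by
    intro m hm
    have h1 := hc₀.step ⟨m, hm⟩
    rw [← hc, ← hc, ← extendWord_fin w hw] at h1
    exact h1
  have hinit : (c 0).1 ∈ A.initial := by
    have := hc 0
    rw [Fin.val_zero] at this
    rw [this]
    exact hc₀.initial_state
  have hnil : ∀ r, (c 0).2 r = none := by
    have := hc 0
    rw [Fin.val_zero] at this
    rw [this]
    exact hc₀.initial_nil
  have hacc : (c w.length).1 ∈ A.accepting := by
    have := hc (Fin.last _)
    rw [Fin.val_last] at this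
    rw [this]
    exact hc₀.accepting_state
  clear_value c
  clear hc hc₀
  generalize extendWord w hw = w' at *
  generalize w.length = n at *
  -- tokens are the witnesses of the values stored before or after a transition
  let T (m : ℕ) : Set ℕ := {p | m < n ∧ ∃ s : Bool, ∃ ξ, A.StoredAt c n (m + s.toNat) ξ ∧
    wit (m + s.toNat) ξ = p}
  have hTsub (m : ℕ) : T m ⊆ Set.range fun x : Bool × A.R =>
      ((c (m + x.1.toNat)).2 x.2).elim 0 (wit (m + x.1.toNat)) := by
    rintro p ⟨-, s, ξ, ⟨-, r, hr⟩, hp⟩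
    exact ⟨(s, r), by simp [hr, hp]⟩
  have hT : TokenFamily T := by
    refine ⟨fun m => (Set.finite_range _).subset (hTsub m), ?_, n, fun m hm => ?_⟩
    · rintro p m m' ⟨h1, s, ξ, h2, rfl⟩ h3
      obtain ⟨h4, h5, h6⟩ := hwit _ _ h2
      refine ⟨by omega, ?_⟩
      -- If `m'` lies strictly closer to `p` than `m`, boundary `m' + 1` is between `m + s.toNat`
      -- and `p + 1`, so the value is still stored there with the same witness.
      by_cases hm : m' = m
      · subst hm; exact ⟨s, ξ, h2, rfl⟩
      · have hs : s.toNat ≤ 1 := Bool.toNat_le s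
        obtain ⟨h7, h8⟩ := h6 (m' + 1) (by omega)
        exact ⟨true, ξ, h7, h8⟩
    · exact Set.eq_empty_of_forall_notMem fun p hp => by have := hp.1; omega
  obtain ⟨J, lev, hJ, hlev, hspan, huniq, hnear⟩ := TokenFamily.exists_levels
    (Nat.card (Bool × A.R)) hT fun m => by
      refine (Set.ncard_le_ncard (hTsub m) (Set.finite_range _)).trans ?_
      rw [← Set.image_univ, ← Set.ncard_univ]
      exact Set.ncard_image_le Set.finite_univ
  have hmono (i : ℕ) : Monotone (J i) := monotone_nat_of_le_succ fun m => by
    rcases hJ i m with h | h <;> omega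
  have hmemT (m : ℕ) (s : Bool) (ξ : U) (hm : m < n) (h : A.StoredAt c n (m + s.toNat) ξ) :
      wit (m + s.toNat) ξ ∈ T m := ⟨hm, s, ξ, h, rfl⟩
  -- pointers
  let ptr (b : ℕ) : A.Pointers A.numLevels := fun r => ((c b).2 r).bind fun ξ =>
    if h : lev (wit b ξ) < A.numLevels then some (⟨_, h⟩, decide (wit b ξ < b)) else none
  have hptr_some (m : ℕ) (s : Bool) (hm : m < n) (r : A.R) (i : Fin A.numLevels) (left : Bool)
      (h : ptr (m + s.toNat) r = some (i, left)) : ∃ ξ, (c (m + s.toNat)).2 r = some ξ ∧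
        lev (wit (m + s.toNat) ξ) = i ∧ (wit (m + s.toNat) ξ < m + s.toNat ↔ left = true) ∧
        A.StoredAt c n (m + s.toNat) ξ := by
    obtain ⟨ξ, h1, h2⟩ := Option.bind_eq_some_iff.1 h
    split_ifs at h2
    simp only [Option.some.injEq, Prod.mk.injEq] at h2
    refine ⟨ξ, h1, congrArg Fin.val h2.1, by simp [← h2.2], ?_, r, h1⟩
    have := Bool.toNat_le s
    omega
  have hptr_of (m : ℕ) (s : Bool) (hm : m < n) (r : A.R) (ξ : U)
      (h : (c (m + s.toNat)).2 r = some ξ) : ∃ i : Fin A.numLevels,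
        lev (wit (m + s.toNat) ξ) = i ∧ ∃ left, ptr (m + s.toNat) r = some (i, left) := by
    have hs : A.StoredAt c n (m + s.toNat) ξ := ⟨by have := Bool.toNat_le s; omega, r, h⟩
    have h1 : lev (wit (m + s.toNat) ξ) < A.numLevels := hlev _ m (hmemT m s ξ hm hs)
    exact ⟨⟨_, h1⟩, rfl, _, by simp only [ptr, h, Option.bind_some, dif_pos h1]; rfl⟩
  -- labels
  have hrule (m : ℕ) : ∃ ρ : A.rules, m < n → ρ.1.1 = (c m).1 ∧ ρ.1.2.1 = (w' m).1 ∧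
      ρ.1.2.2.2 = (c (m + 1)).1 ∧
      ρ.1.2.2.1.Holds (constrVal (c m).2 (w' m).2 (c (m + 1)).2) := by
    by_cases hm : m < n
    · obtain ⟨Φ, h1, h2⟩ := hstep m hm
      exact ⟨⟨_, h1⟩, fun _ => ⟨rfl, rfl, rfl, h2⟩⟩
    · obtain ⟨Φ, h1, h2⟩ := hstep 0 hw
      exact ⟨⟨_, h1⟩, fun h => (hm h).elim⟩
  choose rule hrule using hrule
  -- Cuts with residue `c` start the blocks congruent to `c` modulo 3. The phase of `m` is the
  -- residue `c` for which `m` is in the middle block of three, as `J i m ≡ c + 1`.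
  let θ (m : ℕ) : A.RunLabel A.numLevels := (rule m, ptr (m + Bool.toNat false),
    ptr (m + Bool.toNat true), fun i => ⟨(J i m + 2) % 3, Nat.mod_lt _ (by omega)⟩)
  let Vs : A.SetIndex A.numLevels → Set ℕ := Sum.elim (fun t => {m | m < n ∧ θ m = t})
    (Sum.elim (fun i => {p | p < n ∧ p ∈ T p ∧ lev p = i})
      fun x => {m | m < n ∧ J x.2 m % 3 = x.1 ∧ J x.2 (m - 1) ≠ J x.2 m})
  have hVs (X) : Vs (e.symm (e X)) = Vs X := by rw [e.symm_apply_apply]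
  have hphase (m : ℕ) (f : Fin A.numLevels → Fin 3) (h : (θ m).2.2.2 = f) (i : Fin A.numLevels) :
      (J i m + 2) % 3 = f i := by rw [← h]
  have hnear' (m : ℕ) (s : Bool) (hm : m < n) (ξ : U) (i : Fin A.numLevels) (left : Bool)
      (I : Scope) (h1 : lev (wit (m + s.toNat) ξ) = i)
      (h2 : wit (m + s.toNat) ξ < m + s.toNat ↔ left = true)
      (h3 : A.StoredAt c n (m + s.toNat) ξ) :
      Near (Vs (.inr (.inl i))) I (m + s.toNat) left (wit (m + s.toNat) ξ) := by
    have hp := hmemT m s ξ hm h3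
    have hpp := hT.self_mem hp
    refine ⟨⟨hpp.1, hpp, h1⟩, h2, ?_⟩
    rintro z - ⟨hz1, hz2, hz3⟩ hz4
    have hn := hnear _ z m hp hz2 (h1.trans hz3.symm)
    have hs := Bool.toNat_le s
    refine ⟨?_, ?_⟩
    · rintro ⟨rfl, h4⟩
      have k2 := hz4.2 rfl
      have := hn (Or.inl ⟨h4.le, by omega⟩)
      omega
    · rintro ⟨rfl, h4⟩
      have k2 : ¬ z < m + s.toNat := fun h => Bool.false_ne_true (hz4.1 h)
      have := hn (Or.inr ⟨by omega, h4.le⟩)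
      omega
  refine ⟨fun X => Vs (e.symm X), fun X => ?_, ?_, ?_, ?_, ?_, ?_⟩
  · change Vs (e.symm X) ⊆ _
    rcases e.symm X with t | i | x <;> rintro m ⟨hm, -⟩ <;> exact ⟨Nat.zero_le _, hm⟩
  · intro m hm
    exact ⟨θ m, by rw [hVs]; exact ⟨hm.2, rfl⟩⟩
  · intro m hm hz t ht
    rw [hVs] at ht
    obtain ⟨-, rfl⟩ := ht
    obtain rfl : m = 0 := by
      by_contra h
      exact hz 0 ⟨le_rfl, hw⟩ (Nat.pos_of_ne_zero h)
    refine ⟨?_, fun r => ?_⟩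
    · rw [← (hrule 0 hw).1] at hinit
      exact hinit
    · simp [θ, ptr, hnil]
  · intro m hm hz t ht
    rw [hVs] at ht
    obtain ⟨-, rfl⟩ := ht
    have hmn : m + 1 = n := by
      by_contra h
      have h1 := hm.2
      dsimp only at h1
      exact hz (m + 1) ⟨Nat.zero_le _, by dsimp only; omega⟩ (by omega)
    rw [← hmn, ← (hrule m hm.2).2.2.1] at hacc
    exact hacc
  · rintro m hm m' hm' ⟨h1, h2⟩ t t' ht ht'
    rw [hVs] at ht ht'
    obtain ⟨-, rfl⟩ := ht
    obtain ⟨-, rfl⟩ := ht'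
    obtain rfl : m' = m + 1 := by
      by_contra h
      have h3 := hm'.2
      dsimp only at h3
      exact h2 (m + 1) ⟨Nat.zero_le _, by dsimp only; omega⟩ ⟨by omega, by omega⟩
    exact ⟨(hrule m hm.2).2.2.1.trans (hrule (m + 1) hm'.2).1.symm, rfl⟩
  · intro f
    refine NestedScopes.of_uses _ _ _ _ _ _ _ hw
      (fun i m p => m < n ∧ (θ m).2.2.2 = f ∧ p ∈ T m ∧ lev p = i) (fun _ _ => False)
      ?_ ?_ (fun _ _ _ h => h.elim) ?_ ?_ ?_
    · rintro m p - - (h | ⟨i, h1, h2, h3, h4⟩)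
      · exact h.elim
      · exact ⟨Nat.zero_le _, (hT.self_mem h3).1⟩
    · rintro i i' m p hi ⟨h1, h2, h3, h4⟩ x hx
      rw [hVs] at hx
      obtain ⟨hx1, hx2, hx3⟩ := hx
      dsimp only at hx2 hx3
      have k1 := hspan p m i h3 (by rw [h4]; exact hi)
      have k2 := hphase m f h2 i
      constructor
      -- A cut between `m` and its witness would start block `J i m + 1` or `J i m`, the span being
      -- at most one block, but its number is congruent to `J i m + 2`.
      · rintro ⟨h5, h6⟩
        have k3 := hmono i (show m ≤ x - 1 by omega)
        have k4 := hmono i (show x - 1 ≤ x by omega)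
        have k5 := hmono i h6
        omega
      · rintro ⟨h5, h6⟩
        have k3 := hmono i (show p ≤ x - 1 by omega)
        have k4 := hmono i (show x - 1 ≤ x by omega)
        have k5 := hmono i h6
        omega
    · rintro i m m' p p' ⟨h1, h2, h3, h4⟩ ⟨h1', h2', h3', h4'⟩ hm hx
      refine huniq p p' m m' h3 h3' (h4.trans h4'.symm) ?_
      rw [h4]
      have k1 := hphase m f h2 i
      have k2 := hphase m' f h2' i
      by_contra hne
      have k3 := hmono i hm
      -- Different blocks of the same phase are at least three apart, so block `J i m + 2` starts
      -- between them, and it starts with a cut.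
      obtain ⟨x, h5, h6, h7, h8⟩ := exists_block_start (hJ i) hm (j := J i m + 2) (by omega)
        (by omega)
      refine hx x ?_ ⟨h5, h6⟩
      rw [hVs]
      exact ⟨by omega, by dsimp only; omega, h8⟩
    · rintro i I p hI1 hI2 hp1 hp2 hp m hm t ht htf r left
      simp only [hVs] at ht ⊢
      obtain ⟨hmn, rfl⟩ := ht
      constructor
      · intro h
        obtain ⟨ξ, h1, h2, h3, h4⟩ := hptr_some m false hmn r i left h
        rw [← hp m _ hm.1 hm.2 ⟨hmn, htf, hmemT m false ξ hmn h4, h2⟩]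
        exact hnear' m false hmn ξ i left I h2 h3 h4
      · intro h
        obtain ⟨ξ, h1, h2, h3, h4⟩ := hptr_some m true hmn r i left h
        rw [← hp m _ hm.1 hm.2 ⟨hmn, htf, hmemT m true ξ hmn h4, h2⟩]
        exact hnear' m true hmn ξ i left I h2 h3 h4
    · rintro I ν hI1 hI2 hI3 - hν m hm t ht htf
      simp only [hVs] at ht
      obtain ⟨hmn, rfl⟩ := ht
      obtain ⟨h1, h2, h3, h4⟩ := hrule m hmn
      have hval (s : Bool) : A.pointerVal w' ν (ptr (m + s.toNat)) = (c (m + s.toNat)).2 := by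
        funext r
        cases hr : (c (m + s.toNat)).2 r with
        | none => simp [pointerVal, ptr, hr]
        | some ξ =>
          obtain ⟨i, h5, left, h6⟩ := hptr_of m s hmn r ξ hr
          have h7 : A.StoredAt c n (m + s.toNat) ξ :=
            ⟨by have := Bool.toNat_le s; omega, r, hr⟩
          rw [pointerVal, h6, Option.map_some,
            hν i m _ hm.1 hm.2 ⟨hmn, htf, hmemT m s ξ hmn h7, h5⟩, (hwit _ _ h7).2.1]
      refine ⟨h2.symm, ?_⟩
      change (rule m).1.2.2.1.Holds (constrVal (A.pointerVal w' ν (ptr (m + Bool.toNat false)))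
        (w' m).2 (A.pointerVal w' ν (ptr (m + Bool.toNat true))))
      rw [hval, hval]
      exact h4

/-- Every weakly guessing register automaton has an equivalent sentence of Scoped MSO. -/
theorem WeaklyGuessing.exists_formula [Finite σ] {A : NRA σ 𝔸} (hA : A.WeaklyGuessing) :
    ∃ φ : Formula σ 𝔸 0 0, φ.WellFormed ∧ φ.language = A.language := by
  have _ := A.finite_R
  have _ := A.finite_rules.to_subtype
  let e : A.SetIndex A.numLevels ≃ Fin _ := Finite.equivFin _
  obtain ⟨φ, h1, h2⟩ := A.exists_labelled_sentence e
  have hφ (w : List (σ × U)) (hw : 0 < w.length) : w ∈ φ.language ↔ w ∈ A.language := by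
    rw [φ.mem_language_iff w hw, h2]
    exact ⟨fun ⟨V, _, h⟩ => h.mem_language hw, hA.exists_labelled e hw⟩
  -- Nonemptiness of the word, used to correct the sentence on the empty word.
  obtain ⟨ψ, h3, h5, h4⟩ : ∃ ψ : Formula σ 𝔸 0 0, ψ.WellFormed ∧ (Formula.neg ψ).WellFormed ∧
      ∀ w : List (σ × U), w ∈ ψ.language ↔ 0 < w.length := by
    refine ⟨.ex (.neg (.lt 0 0)), trivial, trivial, fun w => ?_⟩
    change (∃ p : Fin w.length, (p : ℕ) ∈ Set.Ico 0 w.length ∧ ¬ p < p) ↔ _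
    constructor
    · rintro ⟨p, -, -⟩
      exact p.pos
    · exact fun h => ⟨⟨0, h⟩, ⟨le_rfl, h⟩, lt_irrefl _⟩
  have hpos (w : List (σ × U)) : w = [] ∨ 0 < w.length := by
    cases w <;> simp
  by_cases hnil : [] ∈ A.language
  · refine ⟨.or φ (.neg ψ), ⟨h1, h5⟩, Set.ext fun w => ?_⟩
    change w ∈ φ.language ∨ ¬ w ∈ ψ.language ↔ w ∈ A.language
    rw [h4]
    rcases hpos w with rfl | hw
    · simp [hnil]
    · simp [hφ w hw, hw]
  · refine ⟨.and φ ψ, ⟨h1, h3⟩, Set.ext fun w => ?_⟩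
    change w ∈ φ.language ∧ w ∈ ψ.language ↔ w ∈ A.language
    rw [h4]
    rcases hpos w with rfl | hw
    · simp [hnil]
    · simp [hφ w hw, hw]

end NRA

end ScopedMSO

/-- If the atoms have elimination of strong guessing, then nondeterministic register automata with
guessing and Scoped MSO define the same languages of data words. -/
theorem theorem3p2 {U : Type u} [Countable U] [Infinite U] (𝔸 : ScopedMSO.Atoms U)
    (h𝔸 : ScopedMSO.Atoms.EliminatesStrongGuessing.{u, v} 𝔸) (σ : Type v) [Finite σ] :
    {L : Language (σ × U) | ∃ A : ScopedMSO.NRA σ 𝔸, A.language = L} =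
      {L : Language (σ × U) |
        ∃ φ : ScopedMSO.Formula σ 𝔸 0 0, φ.WellFormed ∧ φ.language = L} := by
  ext L
  constructor
  · rintro ⟨A, rfl⟩
    -- The only use of elimination of strong guessing.
    obtain ⟨B, hB, hBA⟩ := h𝔸 σ A
    obtain ⟨φ, h1, h2⟩ := hB.exists_formula
    exact ⟨φ, h1, h2.trans hBA⟩
  · rintro ⟨φ, hφ, rfl⟩
    exact φ.exists_nra_language_eq hφ
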